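/- Let $p\in(1,\infty)$, $\alpha>-1$, and let $X$ be the Hardy space $H^p$ or the weighted Bergman space $A^p_\alpha$ on the open unit disc $\mathbb D$. That is, $X$ consists of the analytic functions $f$ on $\mathbb D$ with $\|f\|_X<\infty$, where $$\|f\|_{H^p}^p=\sup_{0\le r<1}\frac1{2\pi}\int_0^{2\pi}|f(re^{iu})|^p\,du,\qquad \|f\|_{A^p_\alpha}^p=\frac{\alpha+1}{\pi}\int_{\mathbb D}|f(z)|^p(1-|z|^2)^\alpha\,d\mathrm{Leb}(z).$$ For a bounded operator $S$ on $X$ let $\|S\|$ be its operator norm, let $\|S\|_e$ be its essential norm (the distance in operator norm from $S$ to the compact operators on $X$), and let $$\mathrm{EN}(S)=\sup_{(f_n)}\limsup_{n\to\infty}\|Sf_n\|_X,$$ where the supremum is over all weakly null sequences $(f_n)$ of unit vectors of $X$. For every $t\in(0,1)$ let $g_t$ be a continuous function on $\overline{\mathbb D}$ that is analytic in $\mathbb D$, let $\|g_t\|_\infty=\sup_{z\in\mathbb D}|g_t(z)|$, and let $M_{g_t}\colon X\to X$, $f\mapsto g_tf$, be the multiplication operator. Assume that for every $f\in X$ the map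 $t\mapsto M_{g_t}f$ from $(0,1)$ to $X$ is continuous and $\int_0^1\|M_{g_t}f\|_X\,dt<\infty$. Then $f\mapsto\int_0^1M_{g_t}f\,dt$ (an $X$-valued integral) defines a bounded operator on $X$, denoted by $\int_0^1M_{g_t}\,dt$, and the following are equivalent, where integrals of non-negative functions take values in $[0,\infty]$: (a) There exist $\xi,\theta\in\partial\mathbb D$ such that $\theta g_t(\xi)=\|g_t\|_\infty$ for almost every $t\in(0,1)$. (b) At least one of the quantities $\mathrm{EN}\big(\int_0^1M_{g_t}\,dt\big)$, $\big\|\int_0^1M_{g_t}\,dt\big\|_e$, $\big\|\int_0^1M_{g_t}\,dt\big\|$ equals at least one of the quantities $\int_0^1\mathrm{EN}(M_{g_t})\,dt$, $\int_0^1\|M_{g_t}\|_e\,dt$, $\int_0^1\|M_{g_t}\|\,dt$. (c) All six quantities in (b) are equal. -/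

import Mathlib

open MeasureTheory Filter Topology Set
open scoped ENNReal

/-- The two scales of spaces of analytic functions on the unit disc: the Hardy spaces `H^p` and
the weighted Bergman spaces `A^p_α`, `α > -1`. -/
inductive DiscSpaceKind : Type
  | hardy : DiscSpaceKind
  | bergman (α : ℝ) (hα : -1 < α) : DiscSpaceKind

/-- The normalized arc length `du / 2π`, in the angular coordinate `u ∈ (0, 2π]`. -/
noncomputable def circleProbMeasure : Measure ℝ :=
  ENNReal.ofReal (1 / (2 * Real.pi)) • volume.restrict (Ioc 0 (2 * Real.pi))

/-- The weighted area measure `(α + 1) (1 - |z|²)^α dA(z)` on the unit disc, where `dA` is the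
Lebesgue measure divided by `π`; it has total mass one if `α > -1`. -/
noncomputable def bergmanMeasure (α : ℝ) : Measure ℂ :=
  (volume.restrict (Metric.ball (0 : ℂ) 1)).withDensity
    (fun z => ENNReal.ofReal ((α + 1) / Real.pi * (1 - ‖z‖ ^ 2) ^ α))

/-- The (possibly infinite) norm of a function on the disc. In the Hardy case it is the supremum
over `0 ≤ r < 1` of the `L^p` means over the circles of radius `r`; for analytic functions these
means are nondecreasing in `r`, so that it is also their limit as `r → 1`. -/
noncomputable def discNorm : DiscSpaceKind → ℝ≥0∞ → (ℂ → ℂ) → ℝ≥0∞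
  | .hardy, p, f =>
      ⨆ r : Ico (0 : ℝ) 1, eLpNorm (fun u : ℝ => f (circleMap 0 r u)) p circleProbMeasure
  | .bergman α _, p, f => eLpNorm f p (bergmanMeasure α)

theorem circleMap_mem_ball_of_Ico (r : Ico (0 : ℝ) 1) (u : ℝ) :
    circleMap 0 r u ∈ Metric.ball (0 : ℂ) 1 := by
  simp [circleMap, abs_of_nonneg r.2.1, r.2.2]

theorem continuous_comp_circleMap {f : ℂ → ℂ} (hf : DifferentiableOn ℂ f (Metric.ball 0 1))
    (r : Ico (0 : ℝ) 1) : Continuous (fun u : ℝ => f (circleMap 0 r u)) :=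
  hf.continuousOn.comp_continuous (continuous_circleMap 0 r) (circleMap_mem_ball_of_Ico r)

theorem aestronglyMeasurable_bergman {f : ℂ → ℂ}
    (hf : DifferentiableOn ℂ f (Metric.ball 0 1)) (α : ℝ) :
    AEStronglyMeasurable f (bergmanMeasure α) :=
  (hf.continuousOn.aestronglyMeasurable measurableSet_ball).mono_ac
    (withDensity_absolutelyContinuous _ _)

theorem discNorm_zero (k : DiscSpaceKind) (p : ℝ≥0∞) : discNorm k p 0 = 0 := by
  cases k with
  | hardy =>
    have h : (fun _ : ℝ => (0 : ℂ)) = 0 := rfl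
    simp [discNorm, h]
  | bergman α hα => simp [discNorm]

theorem discNorm_add_le (k : DiscSpaceKind) {p : ℝ≥0∞} (hp : 1 ≤ p) {f g : ℂ → ℂ}
    (hf : DifferentiableOn ℂ f (Metric.ball 0 1)) (hg : DifferentiableOn ℂ g (Metric.ball 0 1)) :
    discNorm k p (f + g) ≤ discNorm k p f + discNorm k p g := by
  cases k with
  | hardy =>
    refine iSup_le fun r => ?_
    refine (eLpNorm_add_le (continuous_comp_circleMap hf r).aestronglyMeasurable
      (continuous_comp_circleMap hg r).aestronglyMeasurable hp).trans ?_
    exact add_le_add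
      (le_iSup (fun r : Ico (0 : ℝ) 1 =>
        eLpNorm (fun u : ℝ => f (circleMap 0 r u)) p circleProbMeasure) r)
      (le_iSup (fun r : Ico (0 : ℝ) 1 =>
        eLpNorm (fun u : ℝ => g (circleMap 0 r u)) p circleProbMeasure) r)
  | bergman α hα =>
    exact eLpNorm_add_le (aestronglyMeasurable_bergman hf α) (aestronglyMeasurable_bergman hg α) hp

theorem discNorm_const_smul (k : DiscSpaceKind) (p : ℝ≥0∞) (c : ℂ) (f : ℂ → ℂ) :
    discNorm k p (c • f) = ‖c‖ₑ * discNorm k p f := by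
  cases k with
  | hardy =>
    simp only [discNorm, ENNReal.mul_iSup]
    refine iSup_congr fun r => ?_
    exact eLpNorm_const_smul c (fun u : ℝ => f (circleMap 0 r u)) p circleProbMeasure
  | bergman α hα => exact eLpNorm_const_smul c f p _

theorem discNorm_le_mul (k : DiscSpaceKind) (p : ℝ≥0∞) {f h : ℂ → ℂ} {C : ℝ}
    (hfh : ∀ z, ‖h z‖ ≤ C * ‖f z‖) :
    discNorm k p h ≤ ENNReal.ofReal C * discNorm k p f := by
  cases k with
  | hardy =>
    simp only [discNorm, ENNReal.mul_iSup]
    exact iSup_mono fun r =>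
      eLpNorm_le_mul_eLpNorm_of_ae_le_mul (Eventually.of_forall fun u => hfh _) p
  | bergman α hα =>
    exact eLpNorm_le_mul_eLpNorm_of_ae_le_mul (Eventually.of_forall fun u => hfh _) p

theorem eq_zero_of_discNorm_eq_zero (k : DiscSpaceKind) {p : ℝ≥0∞} (hp : 1 ≤ p) {f : ℂ → ℂ}
    (hf : DifferentiableOn ℂ f (Metric.ball 0 1)) (h0 : discNorm k p f = 0) :
    ∀ z ∈ Metric.ball (0 : ℂ) 1, f z = 0 := by
  have hp0 : p ≠ 0 := (zero_lt_one.trans_le hp).ne'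
  cases k with
  | hardy =>
    intro z hz
    have hz1 : ‖z‖ < 1 := by simpa using hz
    let r : Ico (0 : ℝ) 1 := ⟨‖z‖, norm_nonneg z, hz1⟩
    have hr := (ENNReal.iSup_eq_zero.1 h0) r
    have hc := continuous_comp_circleMap hf r
    rw [eLpNorm_eq_zero_iff hc.aestronglyMeasurable hp0, circleProbMeasure,
      Measure.ae_ennreal_smul_measure_eq
        (by simp [Real.pi_pos] : ENNReal.ofReal (1 / (2 * Real.pi)) ≠ 0)] at hr
    have hIoo : (fun u : ℝ => f (circleMap 0 r u)) =ᵐ[volume.restrict (Ioo 0 (2 * Real.pi))] 0 :=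
      ae_restrict_of_ae_restrict_of_subset Ioo_subset_Ioc_self hr
    have heq := Measure.eqOn_open_of_ae_eq hIoo isOpen_Ioo hc.continuousOn continuousOn_const
    have hcl : EqOn (fun u : ℝ => f (circleMap 0 r u)) 0 (closure (Ioo 0 (2 * Real.pi))) :=
      heq.closure hc continuous_const
    rw [closure_Ioo Real.two_pi_pos.ne] at hcl
    obtain ⟨u, hu, hzu⟩ : ∃ u ∈ Icc 0 (2 * Real.pi), circleMap 0 ‖z‖ u = z := by
      have hmem : z ∈ Metric.sphere (0 : ℂ) |‖z‖| := by simp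
      rw [← image_circleMap_Ioc 0 ‖z‖] at hmem
      obtain ⟨u, hu, h⟩ := hmem
      exact ⟨u, Ioc_subset_Icc_self hu, h⟩
    have := hcl hu
    simpa [r, hzu] using this
  | bergman α hα =>
    have h1 := (eLpNorm_eq_zero_iff (aestronglyMeasurable_bergman hf α) hp0).1 h0
    have hmeas : Measurable
        (fun z : ℂ => ENNReal.ofReal ((α + 1) / Real.pi * (1 - ‖z‖ ^ 2) ^ α)) := by
      fun_prop
    have h2 : f =ᵐ[volume.restrict (Metric.ball (0 : ℂ) 1)] 0 := by
      have h3 := (ae_withDensity_iff hmeas).1 h1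
      filter_upwards [h3, ae_restrict_mem measurableSet_ball] with z hz hzb
      apply hz
      have hz1 : ‖z‖ < 1 := by simpa using hzb
      have h4 : 0 < 1 - ‖z‖ ^ 2 := by nlinarith [norm_nonneg z]
      have h5 : 0 < (α + 1) / Real.pi * (1 - ‖z‖ ^ 2) ^ α :=
        mul_pos (div_pos (by linarith) Real.pi_pos) (Real.rpow_pos_of_pos h4 α)
      simpa using h5
    exact Measure.eqOn_open_of_ae_eq h2 Metric.isOpen_ball hf.continuousOn continuousOn_const

/-- The analytic functions on the unit disc whose norm is finite. A function on the disc is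
represented by its extension by zero to the whole plane. -/
noncomputable def discSubmodule (k : DiscSpaceKind) (p : ℝ≥0∞) [hp : Fact (1 ≤ p)] :
    Submodule ℂ (ℂ → ℂ) where
  carrier := {f | DifferentiableOn ℂ f (Metric.ball 0 1) ∧
    (∀ z ∉ Metric.ball (0 : ℂ) 1, f z = 0) ∧ discNorm k p f < ∞}
  zero_mem' := ⟨differentiableOn_const 0, fun _ _ => rfl, by simp [discNorm_zero]⟩
  add_mem' := fun {f g} hf hg => ⟨hf.1.add hg.1,
    fun z hz => by simp [hf.2.1 z hz, hg.2.1 z hz],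
    (discNorm_add_le k hp.out hf.1 hg.1).trans_lt (ENNReal.add_lt_top.2 ⟨hf.2.2, hg.2.2⟩)⟩
  smul_mem' := fun c f hf => ⟨hf.1.const_smul c,
    fun z hz => by simp [hf.2.1 z hz],
    by rw [discNorm_const_smul]; exact ENNReal.mul_lt_top (by simp) hf.2.2⟩

/-- The space `H^p` (for `k = .hardy`) or `A^p_α` (for `k = .bergman α _`). -/
def DiscSpace (k : DiscSpaceKind) (p : ℝ≥0∞) [Fact (1 ≤ p)] : Type :=
  discSubmodule k p

namespace DiscSpace

variable {k : DiscSpaceKind} {p : ℝ≥0∞} [hp : Fact (1 ≤ p)]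

noncomputable instance : AddCommGroup (DiscSpace k p) :=
  inferInstanceAs (AddCommGroup (discSubmodule k p))

noncomputable instance : Module ℂ (DiscSpace k p) :=
  inferInstanceAs (Module ℂ (discSubmodule k p))

instance : CoeFun (DiscSpace k p) (fun _ => ℂ → ℂ) := ⟨fun f => f.1⟩

noncomputable instance : NormedAddCommGroup (DiscSpace k p) :=
  AddGroupNorm.toNormedAddCommGroup
    { toFun := fun f => (discNorm k p f).toReal
      map_zero' := by
        change (discNorm k p 0).toReal = 0
        simp [discNorm_zero]
      add_le' := fun f g => by
        change (discNorm k p (f.1 + g.1)).toReal ≤ _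
        rw [← ENNReal.toReal_add f.2.2.2.ne g.2.2.2.ne]
        exact ENNReal.toReal_mono (ENNReal.add_lt_top.2 ⟨f.2.2.2, g.2.2.2⟩).ne
          (discNorm_add_le k hp.out f.2.1 g.2.1)
      neg' := fun f => by
        change (discNorm k p (-f.1)).toReal = _
        have h : -f.1 = (-1 : ℂ) • f.1 := by simp
        rw [h, discNorm_const_smul]
        simp
      eq_zero_of_map_eq_zero' := fun f hf => by
        have h0 : discNorm k p f.1 = 0 :=
          ((ENNReal.toReal_eq_zero_iff _).1 hf).resolve_right f.2.2.2.ne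
        refine Subtype.ext (funext fun z => ?_)
        by_cases hz : z ∈ Metric.ball (0 : ℂ) 1
        · exact eq_zero_of_discNorm_eq_zero k hp.out f.2.1 h0 z hz
        · exact f.2.2.1 z hz }

theorem norm_def (f : DiscSpace k p) : ‖f‖ = (discNorm k p f).toReal := rfl

noncomputable instance : NormedSpace ℂ (DiscSpace k p) where
  norm_smul_le c f := by
    rw [norm_def, norm_def]
    change (discNorm k p (c • f.1)).toReal ≤ _
    rw [discNorm_const_smul, ENNReal.toReal_mul]
    simp

end DiscSpace

/-- The disc algebra: functions that are continuous on the closed unit disc and analytic in its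
interior (the values outside the closed disc play no role). -/
structure DiscAlgebra : Type where
  toFun : ℂ → ℂ
  diffContOnCl : DiffContOnCl ℂ toFun (Metric.ball 0 1)

instance : CoeFun DiscAlgebra (fun _ => ℂ → ℂ) := ⟨DiscAlgebra.toFun⟩

/-- The norm `‖g‖_∞`, the supremum of `|g|` over the open unit disc. -/
noncomputable def DiscAlgebra.supNorm (g : DiscAlgebra) : ℝ :=
  ⨆ z : Metric.ball (0 : ℂ) 1, ‖g z‖

theorem DiscAlgebra.norm_le_supNorm (g : DiscAlgebra) {z : ℂ} (hz : z ∈ Metric.ball (0 : ℂ) 1) :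
    ‖g z‖ ≤ g.supNorm := by
  have hc : ContinuousOn g (Metric.closedBall (0 : ℂ) 1) := by
    rw [← closure_ball (0 : ℂ) one_ne_zero]
    exact g.diffContOnCl.continuousOn
  obtain ⟨C, hC⟩ := (isCompact_closedBall (0 : ℂ) 1).exists_bound_of_continuousOn hc
  have hb : BddAbove (range fun z : Metric.ball (0 : ℂ) 1 => ‖g z‖) := by
    refine ⟨C, ?_⟩
    rintro _ ⟨w, rfl⟩
    exact hC w (Metric.ball_subset_closedBall w.2)
  exact le_ciSup hb ⟨z, hz⟩

theorem DiscAlgebra.norm_mul_le {k : DiscSpaceKind} {p : ℝ≥0∞} [Fact (1 ≤ p)]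
    (g : DiscAlgebra) (f : DiscSpace k p) (z : ℂ) :
    ‖g z * f z‖ ≤ g.supNorm * ‖f z‖ := by
  by_cases hz : z ∈ Metric.ball (0 : ℂ) 1
  · rw [norm_mul]
    exact mul_le_mul_of_nonneg_right (g.norm_le_supNorm hz) (norm_nonneg _)
  · simp [f.2.2.1 z hz]

/-- The multiplication operator `M_g : f ↦ g f` on `H^p` or `A^p_α`. -/
noncomputable def mulOp (k : DiscSpaceKind) (p : ℝ≥0∞) [Fact (1 ≤ p)] (g : DiscAlgebra) :
    DiscSpace k p →L[ℂ] DiscSpace k p :=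
  LinearMap.mkContinuous
    { toFun := fun f => ⟨fun z => g z * f z,
        g.diffContOnCl.differentiableOn.mul f.2.1,
        fun z hz => by simp [f.2.2.1 z hz],
        (discNorm_le_mul k p (g.norm_mul_le f)).trans_lt
          (ENNReal.mul_lt_top ENNReal.ofReal_lt_top f.2.2.2)⟩
      map_add' := fun f₁ f₂ => Subtype.ext (funext fun z => mul_add (g z) (f₁ z) (f₂ z))
      map_smul' := fun c f => Subtype.ext (funext fun z => mul_left_comm (g z) c (f z)) }
    g.supNorm
    (fun f => by
      have h0 : 0 ≤ g.supNorm :=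
        (norm_nonneg _).trans (g.norm_le_supNorm (Metric.mem_ball_self one_pos))
      have h := ENNReal.toReal_mono
        (ENNReal.mul_lt_top ENNReal.ofReal_lt_top f.2.2.2).ne
        (discNorm_le_mul k p (g.norm_mul_le f))
      rw [ENNReal.toReal_mul, ENNReal.toReal_ofReal h0] at h
      exact h)

/-- The Lebesgue measure on the interval `]0,1[`. -/
noncomputable instance : MeasureSpace (Ioo (0 : ℝ) 1) := Measure.Subtype.measureSpace

section Operators

variable {X : Type*} [NormedAddCommGroup X] [NormedSpace ℂ X]

/-- Weakly null sequences of unit vectors. -/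
def IsUnitWeaklyNull (f : ℕ → X) : Prop :=
  (∀ n, ‖f n‖ = 1) ∧ ∀ φ : X →L[ℂ] ℂ, Tendsto (fun n => φ (f n)) atTop (𝓝 0)

/-- The weak null maximum `EN(S)`: the supremum of `limsup ‖S f_n‖` over all weakly null sequences
`(f_n)` of unit vectors. -/
noncomputable def weakNullMax (S : X →L[ℂ] X) : ℝ≥0∞ :=
  ⨆ (f : ℕ → X) (_ : IsUnitWeaklyNull f), limsup (fun n => ‖S (f n)‖ₑ) atTop

/-- The essential norm: the distance to the compact operators. -/
noncomputable def essNorm (S : X →L[ℂ] X) : ℝ≥0∞ :=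
  ⨅ (K : X →L[ℂ] X) (_ : IsCompactOperator K), ‖S - K‖ₑ

/-- The condition `W(X)` on a family of operators: for every `f` in `X`, the map `t ↦ S_t f` is
continuous on `]0,1[` and `∫ ‖S_t f‖ dt < ∞`. -/
def SatisfiesW (S : Ioo (0 : ℝ) 1 → X →L[ℂ] X) : Prop :=
  ∀ f : X, Continuous (fun t => S t f) ∧ ∫⁻ t, ‖S t f‖ₑ < ∞

/-- `T` is the integral `∫_0^1 S_t dt`, that is, `T f = ∫_0^1 S_t f dt` (Bochner integral in `X`)
for every `f`; there is at most one such `T`. -/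
def IsStrongIntegral (S : Ioo (0 : ℝ) 1 → X →L[ℂ] X) (T : X →L[ℂ] X) : Prop :=
  ∀ f : X, T f = ∫ t, S t f

end Operators

/-! For a single symbol `g` in the disc algebra, EN(M_g), ‖M_g‖_e and ‖M_g‖ all equal ‖g‖_∞. The
chain EN ≤ essential norm ≤ norm ≤ ‖g‖_∞ is general. For the reverse bound, the maximum principle
gives ξ on the circle with |g(ξ)| = ‖g‖_∞, and the normalized powers of (1 + ξ̄z)/2 form a weakly
null sequence concentrating at ξ, along which ‖g f_n‖ → |g(ξ)| (`DiscSpace.norms_mulOp`). Hence the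
three integrals in (b) are the single number I = ∫ ‖g_t‖_∞ dt.

If I < ∞, then T = ∫ M_{g_t} dt is multiplication by G(z) = ∫ g_t(z) dt, which lies in the disc
algebra by dominated convergence, so the three quantities attached to T equal ‖G‖_∞ ≤ I. Equality is
the equality case of the triangle inequality for ∫ g_t(ξ) dt at a point ξ where |G| is maximal, and
this is condition (a).

Finiteness of I is not assumed. Under (b) it follows from I ≤ ‖T‖; under (a) it follows from Fatou's
lemma along a sequence peaking at ξ, together with the bound ∫ ‖M_{g_t} f‖ dt ≤ C‖f‖.

Weak nullity is proved without describing the dual space: by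
`IsPeaking.eventually_norm_add_rpow_le`, suitable sums of N peaking vectors have norm at most
(2N)^(1/p), whereas a functional not tending to zero on the sequence would be at least Nε on such a
sum. This is impossible for p > 1. -/

/-! ### Finite measures defining the norms -/

/-- The measures on the disc whose `L^p` norms define `discNorm`. -/
noncomputable def discMeasure : DiscSpaceKind → Ico (0 : ℝ) 1 → Measure ℂ
  | .hardy, r => circleProbMeasure.map (circleMap 0 r)
  | .bergman α _, _ => bergmanMeasure α

instance : Nonempty (Ico (0 : ℝ) 1) := ⟨⟨0, by simp⟩⟩

theorem ae_mem_ball_discMeasure (k : DiscSpaceKind) (r : Ico (0 : ℝ) 1) :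
    ∀ᵐ z ∂discMeasure k r, z ∈ Metric.ball (0 : ℂ) 1 := by
  cases k with
  | hardy =>
    refine (ae_map_iff (p := fun z => z ∈ Metric.ball (0 : ℂ) 1)
      (continuous_circleMap 0 _).aemeasurable measurableSet_ball).2 ?_
    exact Eventually.of_forall fun u => circleMap_mem_ball_of_Ico r u
  | bergman α hα =>
    exact (withDensity_absolutelyContinuous _ _).ae_le (ae_restrict_mem measurableSet_ball)

theorem restrict_ball_discMeasure (k : DiscSpaceKind) (r : Ico (0 : ℝ) 1) :
    (discMeasure k r).restrict (Metric.ball 0 1) = discMeasure k r :=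
  Measure.restrict_eq_self_of_ae_mem (ae_mem_ball_discMeasure k r)

theorem ContinuousOn.aestronglyMeasurable_discMeasure {E : Type*} [NormedAddCommGroup E]
    {f : ℂ → E} (hf : ContinuousOn f (Metric.ball 0 1)) (k : DiscSpaceKind) (r : Ico (0 : ℝ) 1) :
    AEStronglyMeasurable f (discMeasure k r) := by
  rw [← restrict_ball_discMeasure]
  exact hf.aestronglyMeasurable measurableSet_ball

/-- This form lets one argument serve both scales: in the Bergman case the family of measures is
constant in `r`. -/
theorem discNorm_eq_iSup (k : DiscSpaceKind) (p : ℝ≥0∞) {f : ℂ → ℂ}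
    (hf : ContinuousOn f (Metric.ball 0 1)) :
    discNorm k p f = ⨆ r, eLpNorm f p (discMeasure k r) := by
  cases k with
  | hardy =>
    refine iSup_congr fun r => ?_
    rw [discMeasure, eLpNorm_map_measure (hf.aestronglyMeasurable_discMeasure .hardy r)
      (continuous_circleMap 0 _).aemeasurable]
    rfl
  | bergman α hα => simp [discNorm, discMeasure]

theorem circleProbMeasure_univ : circleProbMeasure univ = 1 := by
  rw [circleProbMeasure, Measure.smul_apply, Measure.restrict_apply_univ, Real.volume_Ioc,
    smul_eq_mul, ← ENNReal.ofReal_mul (by positivity)]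
  have := Real.pi_ne_zero
  rw [sub_zero, one_div, inv_mul_cancel₀ (by positivity), ENNReal.ofReal_one]

theorem measurable_bergmanDensity (α : ℝ) : Measurable
    (fun z : ℂ => ENNReal.ofReal ((α + 1) / Real.pi * (1 - ‖z‖ ^ 2) ^ α)) := by
  fun_prop

/-- The integrand is the derivative of -(1 - r²)^(α+1), which is continuous up to r = 1 because α +
1 > 0. A nonnegative derivative of such a function is integrable even where it blows up. -/
theorem integrableOn_mul_one_sub_sq_rpow {α : ℝ} (hα : -1 < α) :
    IntegrableOn (fun r : ℝ => 2 * r * (α + 1) * (1 - r ^ 2) ^ α) (Ioc 0 1) := by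
  have ha : 0 < α + 1 := by linarith
  refine intervalIntegral.integrableOn_deriv_of_nonneg
    (g := fun r : ℝ => -(1 - r ^ 2) ^ (α + 1)) ?_ ?_ ?_
  · refine ContinuousOn.neg (ContinuousOn.rpow_const (by fun_prop) fun _ _ => Or.inr ha.le)
  · intro r hr
    have h1 : 0 < 1 - r ^ 2 := by nlinarith [hr.1, hr.2]
    have h2 : HasDerivAt (fun r : ℝ => 1 - r ^ 2) (-(2 * r)) r := by
      simpa using ((hasDerivAt_pow 2 r).const_sub 1)
    refine (h2.rpow_const (p := α + 1) (Or.inl h1.ne')).neg.congr_deriv ?_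
    rw [add_sub_cancel_right]
    ring
  · intro r hr
    have h1 : 0 < 1 - r ^ 2 := by nlinarith [hr.1, hr.2]
    have := hr.1
    positivity

theorem lintegral_bergmanMeasure (α : ℝ) {F : ℂ → ℝ≥0∞} (hF : Measurable F) :
    ∫⁻ z, F z ∂bergmanMeasure α = ∫⁻ r in Ioo (0 : ℝ) 1, ∫⁻ u in Ioo (-Real.pi) Real.pi,
      ENNReal.ofReal r * (ENNReal.ofReal ((α + 1) / Real.pi * (1 - r ^ 2) ^ α) *
        F (circleMap 0 r u)) := by
  have hd := measurable_bergmanDensity α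
  rw [bergmanMeasure, lintegral_withDensity_eq_lintegral_mul _ hd hF,
    ← lintegral_indicator measurableSet_ball, ← Complex.lintegral_comp_polarCoord_symm,
    polarCoord_target, Measure.volume_eq_prod, ← Measure.prod_restrict, lintegral_prod,
    ← lintegral_indicator measurableSet_Ioi, ← lintegral_indicator measurableSet_Ioo]
  · refine lintegral_congr fun r => ?_
    by_cases h0 : 0 < r
    · rw [indicator_of_mem (mem_Ioi.2 h0)]
      by_cases h1 : r < 1
      · rw [indicator_of_mem (mem_Ioo.2 ⟨h0, h1⟩)]
        refine lintegral_congr fun u => ?_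
        have h2 : Complex.polarCoord.symm (r, u) = circleMap 0 r u := by
          rw [Complex.polarCoord_symm_apply, circleMap_zero, Complex.exp_mul_I]
          simp
        rw [h2, indicator_of_mem (circleMap_mem_ball_of_Ico ⟨r, h0.le, h1⟩ u)]
        simp [abs_of_pos h0]
      · rw [indicator_of_notMem (by simp [h1])]
        refine (lintegral_congr fun u => ?_).trans lintegral_zero
        rw [indicator_of_notMem, smul_zero]
        simpa [abs_of_pos h0] using h1
    · rw [indicator_of_notMem (by simpa using h0), indicator_of_notMem (by simp [h0])]
  · refine AEMeasurable.smul (ENNReal.measurable_ofReal.comp measurable_fst).aemeasurable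
      (Measurable.aemeasurable ?_)
    refine ((hd.mul hF).indicator measurableSet_ball).comp ?_
    have : (fun q : ℝ × ℝ => Complex.polarCoord.symm q) =
        fun q : ℝ × ℝ => (q.1 : ℂ) * (Real.cos q.2 + Real.sin q.2 * Complex.I) := by
      ext q; simp [Complex.polarCoord_symm_apply]
    change Measurable (fun q : ℝ × ℝ => Complex.polarCoord.symm q)
    rw [this]
    fun_prop

theorem bergmanMeasure_univ_lt_top {α : ℝ} (hα : -1 < α) : bergmanMeasure α univ < ∞ := by
  rw [← lintegral_one, lintegral_bergmanMeasure α measurable_const]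
  have h : ∀ r ∈ Ioo (0 : ℝ) 1, (∫⁻ u in Ioo (-Real.pi) Real.pi,
      ENNReal.ofReal r * (ENNReal.ofReal ((α + 1) / Real.pi * (1 - r ^ 2) ^ α) * 1)) =
      ‖2 * r * (α + 1) * (1 - r ^ 2) ^ α‖ₑ := by
    intro r hr
    have h1 : 0 < 1 - r ^ 2 := by nlinarith [hr.1, hr.2]
    have h2 := hr.1
    have h3 : 0 < α + 1 := by linarith
    have h4 := Real.pi_pos
    rw [lintegral_const, Measure.restrict_apply_univ, Real.volume_Ioo, mul_one,
      ← ENNReal.ofReal_mul h2.le, ← ENNReal.ofReal_mul (by positivity),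
      Real.enorm_of_nonneg (by positivity)]
    congr 1
    field_simp
    ring
  rw [setLIntegral_congr_fun measurableSet_Ioo h]
  exact (((integrableOn_mul_one_sub_sq_rpow hα).mono_set Ioo_subset_Ioc_self).2)

theorem exists_discMeasure_univ_le (k : DiscSpaceKind) :
    ∃ M : ℝ≥0∞, M ≠ ∞ ∧ ∀ r, discMeasure k r univ ≤ M := by
  cases k with
  | hardy =>
    refine ⟨1, ENNReal.one_ne_top, fun r => ?_⟩
    rw [discMeasure, Measure.map_apply (continuous_circleMap 0 _).measurable .univ, preimage_univ,
      circleProbMeasure_univ]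
  | bergman α hα => exact ⟨_, (bergmanMeasure_univ_lt_top hα).ne, fun r => le_rfl⟩

theorem isFiniteMeasure_discMeasure (k : DiscSpaceKind) (r : Ico (0 : ℝ) 1) :
    IsFiniteMeasure (discMeasure k r) := by
  obtain ⟨M, hM, h⟩ := exists_discMeasure_univ_le k
  exact ⟨(h r).trans_lt hM.lt_top⟩

/-- Rotate by e^{-iu} and keep only the imaginary part. The bound does not involve `r`, which makes
the smallness of arcs near a boundary point uniform over all circles. -/
theorem abs_sin_sub_le_norm_circleMap_sub (r u s : ℝ) :
    |Real.sin (u - s)| ≤ ‖circleMap 0 r u - circleMap 0 1 s‖ := by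
  have h : circleMap 0 r u - circleMap 0 1 s =
      (r - Complex.exp ((s - u : ℝ) * Complex.I)) * Complex.exp (u * Complex.I) := by
    rw [sub_mul, ← Complex.exp_add]
    simp only [circleMap_zero]
    push_cast
    ring_nf
  rw [h, norm_mul, Complex.norm_exp_ofReal_mul_I, mul_one]
  refine le_trans (le_of_eq ?_) (Complex.abs_im_le_norm _)
  rw [Complex.sub_im, Complex.exp_ofReal_mul_I_im, Complex.ofReal_im, zero_sub, ← Real.sin_neg,
    neg_sub]

theorem exists_measure_sublevel_le {Ω : Type*} [MeasurableSpace Ω] {μ : Measure Ω}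
    [IsFiniteMeasure μ] {d : Ω → ℝ} (hd : Measurable d) (h0 : μ {x | d x ≤ 0} = 0)
    {ε : ℝ≥0∞} (hε : 0 < ε) : ∃ δ > 0, μ {x | d x < δ} ≤ ε := by
  have ht : Tendsto (fun n : ℕ => μ {x | d x < 1 / ((n : ℝ) + 1)}) atTop
      (𝓝 (μ (⋂ n : ℕ, {x | d x < 1 / ((n : ℝ) + 1)}))) := by
    refine tendsto_measure_iInter_atTop
      (fun n => (measurableSet_lt hd measurable_const).nullMeasurableSet) ?_
      ⟨0, measure_ne_top _ _⟩
    intro m n hmn x hx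
    exact lt_of_lt_of_le (b := 1 / ((n : ℝ) + 1)) hx (Nat.one_div_le_one_div hmn)
  have hz : μ (⋂ n : ℕ, {x | d x < 1 / ((n : ℝ) + 1)}) = 0 := by
    refine measure_mono_null (fun x hx => ?_) h0
    change d x ≤ 0
    refine le_of_forall_pos_lt_add fun e he => ?_
    obtain ⟨n, hn⟩ := exists_nat_one_div_lt he
    rw [zero_add]
    exact lt_trans (mem_iInter.1 hx n) hn
  rw [hz] at ht
  obtain ⟨n, hn⟩ := (ht.eventually (gt_mem_nhds hε)).exists
  exact ⟨_, Nat.one_div_pos_of_nat, hn.le⟩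

/-- The uniformity in `r` is what matters: the norm is a supremum over `r`, so a bounded function
must be small near ξ for all the measures at once. -/
theorem exists_discMeasure_ball_le (k : DiscSpaceKind) {ξ : ℂ} (hξ : ‖ξ‖ = 1) {ε : ℝ≥0∞}
    (hε : 0 < ε) : ∃ δ > 0, ∀ r, discMeasure k r (Metric.ball ξ δ) ≤ ε := by
  cases k with
  | hardy =>
    have : IsFiniteMeasure circleProbMeasure := ⟨by simp [circleProbMeasure_univ]⟩
    obtain ⟨s, hs⟩ : ∃ s : ℝ, circleMap 0 1 s = ξ := by
      have : ξ ∈ range (circleMap 0 1) := by simp [range_circleMap, hξ]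
      exact this
    have h0 : circleProbMeasure {u | |Real.sin (u - s)| ≤ 0} = 0 := by
      have hc : {u : ℝ | |Real.sin (u - s)| ≤ 0}.Countable := by
        refine (countable_range fun n : ℤ => n * Real.pi + s).mono fun u hu => ?_
        have h1 : Real.sin (u - s) = 0 := abs_nonpos_iff.1 hu
        obtain ⟨n, hn⟩ := Real.sin_eq_zero_iff.1 h1
        exact ⟨n, by simp [hn]⟩
      rw [circleProbMeasure, Measure.smul_apply, hc.measure_zero, smul_zero]
    obtain ⟨δ, hδ, h⟩ := exists_measure_sublevel_le (by fun_prop) h0 hε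
    refine ⟨δ, hδ, fun r => ?_⟩
    rw [discMeasure, Measure.map_apply (continuous_circleMap 0 _).measurable measurableSet_ball]
    refine (measure_mono fun u hu => ?_).trans h
    refine (abs_sin_sub_le_norm_circleMap_sub r u s).trans_lt ?_
    rw [hs, ← dist_eq_norm]
    exact hu
  | bergman α hα =>
    have : IsFiniteMeasure (bergmanMeasure α) := ⟨bergmanMeasure_univ_lt_top hα⟩
    have h0 : bergmanMeasure α {z | dist z ξ ≤ 0} = 0 := by
      refine (withDensity_absolutelyContinuous _ _)
        (Measure.absolutelyContinuous_of_le Measure.restrict_le_self ?_)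
      have : {z : ℂ | dist z ξ ≤ 0} = {ξ} := by ext; simp [dist_le_zero]
      rw [this]
      simp
    obtain ⟨δ, hδ, h⟩ := exists_measure_sublevel_le (by fun_prop) h0 hε
    exact ⟨δ, hδ, fun r => h⟩

/-! ### Point evaluations are locally uniformly bounded -/

/-- Cauchy's formula on the circle of radius ρ: the kernel is at most 1/(ρ - R), and the factors
1/(2π) and ρ are estimated by 1. -/
theorem enorm_le_lintegral_circleMap {f : ℂ → ℂ} (hf : DifferentiableOn ℂ f (Metric.ball 0 1))
    {z : ℂ} {R ρ : ℝ} (hz : ‖z‖ ≤ R) (hR : R < ρ) (hρ : ρ < 1) :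
    ‖f z‖ₑ ≤ ENNReal.ofReal (1 / (ρ - R)) *
      ∫⁻ u in Ioc 0 (2 * Real.pi), ‖f (circleMap 0 ρ u)‖ₑ := by
  have hρ0 : 0 < ρ := ((norm_nonneg z).trans hz).trans_lt hR
  have hd : DiffContOnCl ℂ f (Metric.ball 0 ρ) := by
    refine (hf.mono ?_).diffContOnCl
    rw [closure_ball _ hρ0.ne']
    exact Metric.closedBall_subset_ball hρ
  have hc := hd.two_pi_i_inv_smul_circleIntegral_sub_inv_smul (w := z)
    (by simpa using hz.trans_lt hR)
  rw [← hc, circleIntegral, intervalIntegral.integral_of_le Real.two_pi_pos.le,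
    ← lintegral_const_mul' _ _ ENNReal.ofReal_ne_top, enorm_smul]
  have h1 : ‖(2 * Real.pi * Complex.I : ℂ)⁻¹‖ₑ ≤ 1 := by
    rw [← ofReal_norm, ← ENNReal.ofReal_one]
    refine ENNReal.ofReal_le_ofReal ?_
    rw [norm_inv]
    refine inv_le_one_of_one_le₀ ?_
    simp only [norm_mul, Complex.norm_ofNat, Complex.norm_real, Complex.norm_I, mul_one,
      Real.norm_eq_abs, abs_of_pos Real.pi_pos]
    linarith [Real.pi_gt_three]
  refine (mul_le_mul_left h1 _).trans ?_
  rw [one_mul]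
  refine (enorm_integral_le_lintegral_enorm _).trans (lintegral_mono fun u => ?_)
  rw [enorm_smul, enorm_smul, ← mul_assoc]
  refine mul_le_mul_left ?_ _
  rw [← ofReal_norm, ← ofReal_norm, ← ENNReal.ofReal_mul (norm_nonneg _)]
  refine ENNReal.ofReal_le_ofReal ?_
  have h2 : ρ - R ≤ ‖circleMap 0 ρ u - z‖ := by
    have := norm_sub_norm_le (circleMap 0 ρ u) z
    rw [norm_circleMap_zero, abs_of_pos hρ0] at this
    linarith
  have h3 : ‖deriv (circleMap 0 ρ) u‖ ≤ 1 := by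
    simp [abs_of_pos hρ0, hρ.le]
  rw [norm_inv, one_div]
  refine (mul_le_mul_of_nonneg_right h3 (by positivity)).trans ?_
  rw [one_mul]
  exact inv_anti₀ (by linarith) h2

/-- Polar coordinates use angles in (-π, π). The change of interval is a translation by π, that is,
the previous estimate for w ↦ f(-w). -/
theorem enorm_le_lintegral_circleMap' {f : ℂ → ℂ} (hf : DifferentiableOn ℂ f (Metric.ball 0 1))
    {z : ℂ} {R ρ : ℝ} (hz : ‖z‖ ≤ R) (hR : R < ρ) (hρ : ρ < 1) :
    ‖f z‖ₑ ≤ ENNReal.ofReal (1 / (ρ - R)) *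
      ∫⁻ u in Ioo (-Real.pi) Real.pi, ‖f (circleMap 0 ρ u)‖ₑ := by
  have hf' : DifferentiableOn ℂ (fun w => f (-w)) (Metric.ball 0 1) :=
    hf.comp differentiableOn_id.neg fun w hw => by simpa using hw
  have h := enorm_le_lintegral_circleMap hf' (z := -z) (by simpa using hz) hR hρ
  rw [neg_neg] at h
  refine h.trans_eq ?_
  congr 1
  have h1 := (measurePreserving_sub_right volume Real.pi).setLIntegral_comp_preimage_emb
    (measurableEmbedding_subRight Real.pi) (fun u => ‖f (circleMap 0 ρ u)‖ₑ)
    (Ioc (-Real.pi) Real.pi)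
  rw [restrict_Ioo_eq_restrict_Ioc, ← h1, preimage_sub_const_Ioc, neg_add_cancel, ← two_mul]
  refine lintegral_congr fun u => ?_
  have h2 : circleMap 0 ρ (u - Real.pi) = -circleMap 0 ρ u := by
    rw [circleMap_zero, circleMap_zero, Complex.ofReal_sub, sub_mul, Complex.exp_sub,
      Complex.exp_pi_mul_I, div_neg, div_one, mul_neg]
  change ‖f (-circleMap 0 ρ u)‖ₑ = ‖f (circleMap 0 ρ (u - Real.pi))‖ₑ
  rw [h2]

/-- In the Hardy case one circle suffices. In the Bergman case the Cauchy estimate is integrated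
over the radii between ρ and 1 against the radial density. -/
theorem exists_enorm_le_lintegral_discMeasure (k : DiscSpaceKind) {R : ℝ} (hR0 : 0 ≤ R)
    (hR : R < 1) : ∃ C : ℝ≥0∞, C ≠ ∞ ∧ ∃ r, ∀ f : ℂ → ℂ,
      DifferentiableOn ℂ f (Metric.ball 0 1) → ∀ z, ‖z‖ ≤ R →
        ‖f z‖ₑ ≤ C * ∫⁻ w, ‖f w‖ₑ ∂discMeasure k r := by
  set ρ := (R + 1) / 2 with hρ
  have h1 : R < ρ := by linarith
  have h2 : ρ < 1 := by linarith
  cases k with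
  | hardy =>
    have hc0 : ENNReal.ofReal (1 / (2 * Real.pi)) ≠ 0 := by simp [Real.pi_pos]
    refine ⟨ENNReal.ofReal (1 / (ρ - R)) * (ENNReal.ofReal (1 / (2 * Real.pi)))⁻¹,
      ENNReal.mul_ne_top ENNReal.ofReal_ne_top (ENNReal.inv_ne_top.2 hc0),
      ⟨ρ, by linarith, h2⟩, fun f hf z hz => ?_⟩
    refine (enorm_le_lintegral_circleMap hf hz h1 h2).trans_eq ?_
    rw [discMeasure, lintegral_map' _ (continuous_circleMap 0 _).aemeasurable, circleProbMeasure,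
      lintegral_smul_measure, smul_eq_mul, mul_assoc, ← mul_assoc _⁻¹,
      ENNReal.inv_mul_cancel hc0 ENNReal.ofReal_ne_top, one_mul]
    exact (hf.continuousOn.aestronglyMeasurable_discMeasure .hardy ⟨ρ, by linarith, h2⟩).enorm
  | bergman α hα =>
    set D : ℝ → ℝ≥0∞ := fun r =>
      ENNReal.ofReal r * ENNReal.ofReal ((α + 1) / Real.pi * (1 - r ^ 2) ^ α)
    have hDm : Measurable D := by fun_prop
    set m : ℝ≥0∞ := ∫⁻ r in Ioo ρ 1, D r * ENNReal.ofReal (ρ - R)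
    have hm : m ≠ 0 := by
      refine (setLIntegral_pos_iff (hDm.mul_const _)).2 ?_ |>.ne'
      have : Ioo ρ 1 ⊆ Function.support (fun r => D r * ENNReal.ofReal (ρ - R)) := by
        intro r hr
        have h4 : 0 < r := by linarith [hr.1]
        have h3 : 0 < 1 - r ^ 2 := by nlinarith [hr.2]
        have h5 : 0 < α + 1 := by linarith
        have h6 := Real.rpow_pos_of_pos h3 α
        have h7 := Real.pi_pos
        refine mul_ne_zero (mul_ne_zero ?_ ?_) ?_
        · simpa using h4
        · have : 0 < (α + 1) / Real.pi * (1 - r ^ 2) ^ α := by positivity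
          simpa using this
        · simpa using h1
      rw [inter_eq_self_of_subset_right this]
      simp [h2]
    -- Truncating at 1 makes the divisor finite without estimating `m` from above.
    have hm1 : min m 1 ≠ 0 := by simp [hm]
    have hm2 : min m 1 ≠ ∞ := (min_le_right _ _).trans_lt ENNReal.one_lt_top |>.ne
    refine ⟨(min m 1)⁻¹, ENNReal.inv_ne_top.2 hm1, ⟨0, by simp⟩, fun f hf z hz => ?_⟩
    rw [← ENNReal.div_eq_inv_mul, ENNReal.le_div_iff_mul_le (Or.inl hm1) (Or.inl hm2), mul_comm]
    refine (mul_le_mul_left (min_le_left _ _) _).trans ?_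
    set F : ℂ → ℝ≥0∞ := (Metric.ball 0 1).indicator fun w => ‖f w‖ₑ
    have hF : Measurable F := by
      classical
      change Measurable ((Metric.ball 0 1).indicator fun w => ‖f w‖ₑ)
      rw [← piecewise_eq_indicator]
      exact ContinuousOn.measurable_piecewise hf.continuousOn.enorm continuousOn_const
        measurableSet_ball
    have hFf : ∫⁻ w, ‖f w‖ₑ ∂discMeasure (.bergman α hα) ⟨0, by simp⟩ =
        ∫⁻ w, F w ∂bergmanMeasure α := by
      refine lintegral_congr_ae ?_
      filter_upwards [ae_mem_ball_discMeasure (.bergman α hα) ⟨0, by simp⟩] with w hw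
      exact (indicator_of_mem hw fun w => ‖f w‖ₑ).symm
    rw [hFf, lintegral_bergmanMeasure α hF, ← lintegral_mul_const' _ _ enorm_ne_top]
    refine le_trans (setLIntegral_mono' measurableSet_Ioo fun r hr => ?_)
      (lintegral_mono_set (Ioo_subset_Ioo_left (by linarith)))
    have h3 := enorm_le_lintegral_circleMap' hf hz (h1.trans hr.1) hr.2
    have h5 : 0 < r := by linarith [hr.1]
    -- For r > ρ the Cauchy constant 1/(r - R) is at most 1/(ρ - R), so one constant works for every
    -- radius.
    have h4 : ENNReal.ofReal (ρ - R) * ‖f z‖ₑ ≤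
        ∫⁻ u in Ioo (-Real.pi) Real.pi, F (circleMap 0 r u) := by
      have h6 : ∀ u, F (circleMap 0 r u) = ‖f (circleMap 0 r u)‖ₑ := fun u =>
        indicator_of_mem (circleMap_mem_ball_of_Ico ⟨r, h5.le, hr.2⟩ u) _
      simp_rw [h6]
      refine (mul_le_mul_right h3 _).trans ?_
      rw [← mul_assoc, ← ENNReal.ofReal_mul (by linarith)]
      refine (mul_le_mul_left (ENNReal.ofReal_le_one.2 ?_) _).trans_eq (one_mul _)
      rw [mul_one_div]
      exact div_le_one_of_le₀ (by linarith [hr.1]) (by linarith [hr.1])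
    simp_rw [← mul_assoc]
    rw [lintegral_const_mul' _ _ (ENNReal.mul_ne_top ENNReal.ofReal_ne_top ENNReal.ofReal_ne_top),
      mul_assoc]
    exact mul_le_mul_right h4 _

theorem exists_enorm_le_discNorm (k : DiscSpaceKind) {p : ℝ≥0∞} (hp : 1 ≤ p) {R : ℝ}
    (hR0 : 0 ≤ R) (hR : R < 1) : ∃ C : ℝ≥0∞, C ≠ ∞ ∧ ∀ f : ℂ → ℂ,
      DifferentiableOn ℂ f (Metric.ball 0 1) → ∀ z, ‖z‖ ≤ R → ‖f z‖ₑ ≤ C * discNorm k p f := by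
  obtain ⟨C, hC, r, h⟩ := exists_enorm_le_lintegral_discMeasure k hR0 hR
  have := isFiniteMeasure_discMeasure k r
  have hexp : 0 ≤ 1 / (1 : ℝ≥0∞).toReal - 1 / p.toReal := by
    rcases eq_or_ne p ∞ with rfl | hp'
    · simp
    · have : 1 ≤ p.toReal := by
        rw [← ENNReal.toReal_one]; exact ENNReal.toReal_mono hp' hp
      simpa using inv_le_one_of_one_le₀ this
  refine ⟨C * discMeasure k r univ ^ (1 / (1 : ℝ≥0∞).toReal - 1 / p.toReal),
    ENNReal.mul_ne_top hC (ENNReal.rpow_ne_top_of_nonneg hexp (measure_ne_top _ _)),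
    fun f hf z hz => ?_⟩
  refine (h f hf z hz).trans ?_
  rw [mul_assoc]
  refine mul_le_mul_right ?_ _
  rw [← eLpNorm_one_eq_lintegral_enorm, mul_comm, discNorm_eq_iSup k p hf.continuousOn]
  refine (eLpNorm_le_eLpNorm_mul_rpow_measure_univ hp
    (hf.continuousOn.aestronglyMeasurable_discMeasure k r)).trans ?_
  exact mul_le_mul_left (le_iSup (fun r => eLpNorm f p (discMeasure k r)) r) _

/-! ### Completeness of the spaces -/

namespace DiscSpace

variable {k : DiscSpaceKind} {p : ℝ≥0∞} [hp : Fact (1 ≤ p)]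

theorem differentiableOn (f : DiscSpace k p) : DifferentiableOn ℂ f (Metric.ball 0 1) := f.2.1

theorem ofReal_norm (f : DiscSpace k p) : ENNReal.ofReal ‖f‖ = discNorm k p f :=
  ENNReal.ofReal_toReal f.2.2.2.ne

theorem sub_apply (f g : DiscSpace k p) (z : ℂ) : (f - g) z = f z - g z := rfl

theorem exists_norm_apply_le (k : DiscSpaceKind) (p : ℝ≥0∞) [Fact (1 ≤ p)] {R : ℝ} (hR : R < 1) :
    ∃ C : ℝ, ∀ f : DiscSpace k p, ∀ z, ‖z‖ ≤ R → ‖f z‖ ≤ C * ‖f‖ := by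
  rcases lt_or_ge R 0 with h0 | h0
  · exact ⟨0, fun f z hz => absurd ((norm_nonneg z).trans hz) h0.not_ge⟩
  obtain ⟨C, hC, h⟩ := exists_enorm_le_discNorm k (Fact.out : 1 ≤ p) h0 hR
  refine ⟨C.toReal, fun f z hz => ?_⟩
  have := ENNReal.toReal_mono (ENNReal.mul_ne_top hC f.2.2.2.ne) (h f f.2.1 z hz)
  rwa [toReal_enorm, ENNReal.toReal_mul] at this

/-- Point evaluation as a continuous linear functional. -/
noncomputable def eval (k : DiscSpaceKind) (p : ℝ≥0∞) [Fact (1 ≤ p)] (z : ℂ) :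
    DiscSpace k p →L[ℂ] ℂ :=
  LinearMap.mkContinuousOfExistsBound
    { toFun := fun f => f z
      map_add' := fun _ _ => rfl
      map_smul' := fun _ _ => rfl } (by
    by_cases hz : z ∈ Metric.ball (0 : ℂ) 1
    · obtain ⟨C, hC⟩ := exists_norm_apply_le k p (R := ‖z‖) (by simpa using hz)
      exact ⟨C, fun f => hC f z le_rfl⟩
    · refine ⟨0, fun f => ?_⟩
      change ‖f z‖ ≤ _
      rw [f.2.2.1 z hz]
      simp)

@[simp] theorem eval_apply (z : ℂ) (f : DiscSpace k p) : eval k p z f = f z := rfl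

/-- A Cauchy sequence converges locally uniformly by the evaluation bounds, so its limit is
analytic; Fatou's lemma for each measure upgrades this to convergence in norm. Completeness is
needed for the Bochner integral and for the Baire argument in `SatisfiesW.exists_lintegral_le`. -/
instance : CompleteSpace (DiscSpace k p) := by
  refine Metric.complete_of_cauchySeq_tendsto fun F hF => ?_
  have hpt : ∀ z, ∃ c, Tendsto (fun n => F n z) atTop (𝓝 c) := fun z =>
    cauchySeq_tendsto_of_complete ((eval k p z).uniformContinuous.comp_cauchySeq hF)
  choose f hf using hpt
  have hu : TendstoLocallyUniformlyOn (fun n => (F n : ℂ → ℂ)) f atTop (Metric.ball 0 1) := by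
    refine tendstoLocallyUniformlyOn_of_forall_exists_nhds fun z hz => ?_
    have hz1 : ‖z‖ < 1 := by simpa using hz
    obtain ⟨R, hzR, hR⟩ := exists_between hz1
    refine ⟨Metric.ball 0 R, mem_nhdsWithin_of_mem_nhds
      (Metric.isOpen_ball.mem_nhds (by simpa using hzR)), ?_⟩
    obtain ⟨C, hC⟩ := exists_norm_apply_le k p hR
    refine UniformCauchySeqOn.tendstoUniformlyOn_of_tendsto ?_ fun z _ => hf z
    rw [Metric.uniformCauchySeqOn_iff]
    intro ε hε
    obtain ⟨N, hN⟩ := Metric.cauchySeq_iff.1 hF (ε / (|C| + 1)) (by positivity)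
    refine ⟨N, fun m hm n hn z hz => ?_⟩
    have h1 := hC (F m - F n) z (mem_ball_zero_iff.1 hz).le
    have h2 := hN m hm n hn
    rw [dist_eq_norm] at h2 ⊢
    rw [lt_div_iff₀ (by positivity)] at h2
    rw [sub_apply] at h1
    have h3 : C * ‖F m - F n‖ ≤ |C| * ‖F m - F n‖ :=
      mul_le_mul_of_nonneg_right (le_abs_self C) (norm_nonneg _)
    have h4 := norm_nonneg (F m - F n)
    linarith
  have hd : DifferentiableOn ℂ f (Metric.ball 0 1) :=
    hu.differentiableOn (Eventually.of_forall fun n => (F n).differentiableOn) Metric.isOpen_ball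
  have hlim : ∀ ε : ℝ, 0 < ε → ∃ N, ∀ n ≥ N,
      discNorm k p ((F n : ℂ → ℂ) - f) ≤ ENNReal.ofReal ε := by
    intro ε hε
    obtain ⟨N, hN⟩ := Metric.cauchySeq_iff.1 hF ε hε
    refine ⟨N, fun n hn => ?_⟩
    rw [discNorm_eq_iSup k p ((F n).differentiableOn.sub hd).continuousOn]
    refine iSup_le fun r => ?_
    refine (Lp.eLpNorm_lim_le_liminf_eLpNorm
      (f := fun m => (F n : ℂ → ℂ) - (F m : ℂ → ℂ)) (fun m =>
        ((F n).differentiableOn.sub (F m).differentiableOn).continuousOn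
          |>.aestronglyMeasurable_discMeasure k r) _
      (Eventually.of_forall fun z => tendsto_const_nhds.sub (hf z))).trans ?_
    refine liminf_le_of_frequently_le' (Eventually.frequently ?_)
    filter_upwards [eventually_ge_atTop N] with m hm
    have h1 := (hN n hn m hm).le
    rw [dist_eq_norm] at h1
    refine le_trans ?_ (ENNReal.ofReal_le_ofReal h1)
    rw [ofReal_norm, discNorm_eq_iSup k p (F n - F m).differentiableOn.continuousOn]
    exact le_iSup (fun r => eLpNorm ((F n : ℂ → ℂ) - (F m : ℂ → ℂ)) p (discMeasure k r)) r
  obtain ⟨N, hN⟩ := hlim 1 one_pos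
  have hfin : discNorm k p f < ∞ := by
    have h1 : f = F N + (-1 : ℂ) • ((F N : ℂ → ℂ) - f) := by ext; simp
    rw [h1]
    refine (discNorm_add_le k hp.out (F N).differentiableOn
      (((F N).differentiableOn.sub hd).const_smul _)).trans_lt (ENNReal.add_lt_top.2
        ⟨(F N).2.2.2, ?_⟩)
    rw [discNorm_const_smul]
    exact ENNReal.mul_lt_top (by simp) ((hN N le_rfl).trans_lt ENNReal.ofReal_lt_top)
  let f' : DiscSpace k p := ⟨f, hd, fun z hz => tendsto_nhds_unique (hf z)
    (tendsto_const_nhds.congr fun n => ((F n).2.2.1 z hz).symm), hfin⟩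
  refine ⟨f', Metric.tendsto_atTop.2 fun ε hε => ?_⟩
  obtain ⟨N, hN⟩ := hlim (ε / 2) (half_pos hε)
  refine ⟨N, fun n hn => lt_of_le_of_lt ?_ (half_lt_self hε)⟩
  rw [dist_eq_norm]
  exact ENNReal.toReal_le_of_le_ofReal (half_pos hε).le (hN n hn)

end DiscSpace

/-! ### Weak null maximum, essential norm and norm -/

section Operators

variable {X : Type*} [NormedAddCommGroup X] [NormedSpace ℂ X]

theorem IsUnitWeaklyNull.tendsto_compact {f : ℕ → X} (hf : IsUnitWeaklyNull f) {K : X →L[ℂ] X}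
    (hK : IsCompactOperator K) : Tendsto (fun n => K (f n)) atTop (𝓝 0) := by
  obtain ⟨S, hS, hKS⟩ := hK.image_closedBall_subset_compact (f := (K : X →ₗ[ℂ] X)) 1
  have hmem : ∀ n, K (f n) ∈ S := fun n =>
    hKS ⟨f n, by simp [hf.1 n], rfl⟩
  refine tendsto_of_subseq_tendsto fun ns hns => ?_
  obtain ⟨y, -, ms, hms, hy⟩ := hS.tendsto_subseq fun n => hmem (ns n)
  refine ⟨ms, ?_⟩
  have hy0 : y = 0 := by
    refine SeparatingDual.eq_zero_of_forall_dual_eq_zero (R := ℂ) fun φ => ?_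
    have h1 := (φ.continuous.tendsto y).comp hy
    have h2 := ((hf.2 (φ.comp K)).comp hns).comp hms.tendsto_atTop
    exact tendsto_nhds_unique h1 h2
  rw [← hy0]
  exact hy

/-- A compact `K` sends weakly null sequences to norm null ones, so replacing `S` by `S - K` does
not change the limsup. -/
theorem weakNullMax_le_essNorm (S : X →L[ℂ] X) : weakNullMax S ≤ essNorm S := by
  refine iSup₂_le fun f hf => le_iInf₂ fun K hK => ?_
  have h0 : Tendsto (fun n => ‖S - K‖ₑ + ‖K (f n)‖ₑ) atTop (𝓝 (‖S - K‖ₑ + ‖(0 : X)‖ₑ)) :=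
    tendsto_const_nhds.add (hf.tendsto_compact hK).enorm
  rw [enorm_zero, add_zero] at h0
  rw [← h0.limsup_eq]
  refine limsup_le_limsup (Eventually.of_forall fun n => ?_)
  have h1 : S (f n) = (S - K) (f n) + K (f n) := by simp
  beta_reduce
  rw [h1]
  refine (enorm_add_le _ _).trans (add_le_add_left ?_ _)
  refine ((S - K).le_opENorm (f n)).trans_eq ?_
  rw [← ofReal_norm (f n), hf.1 n, ENNReal.ofReal_one, mul_one]

theorem essNorm_le_enorm (S : X →L[ℂ] X) : essNorm S ≤ ‖S‖ₑ :=
  (iInf₂_le (f := fun (K : X →L[ℂ] X) (_ : IsCompactOperator K) => ‖S - K‖ₑ) 0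
    isCompactOperator_zero).trans_eq (by rw [sub_zero])

end Operators

/-! ### Peaking sequences at a boundary point -/

/-- Minkowski's inequality; `M` is the p-th root of a common bound for the total masses. It turns
estimates of the type "small near ξ, small away from ξ" into norm estimates. -/
theorem exists_discNorm_le_add (k : DiscSpaceKind) {p : ℝ≥0∞} (hp : 1 ≤ p) (hp' : p ≠ ∞) :
    ∃ M : ℝ, ∀ (f h : ℂ → ℂ) (A c : ℝ), 0 ≤ A → 0 ≤ c →
      DifferentiableOn ℂ f (Metric.ball 0 1) → DifferentiableOn ℂ h (Metric.ball 0 1) →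
      (∀ z ∈ Metric.ball (0 : ℂ) 1, ‖f z‖ ≤ A * ‖h z‖ + c) →
      discNorm k p f ≤ ENNReal.ofReal A * discNorm k p h + ENNReal.ofReal (c * M) := by
  obtain ⟨M, hM, hMr⟩ := exists_discMeasure_univ_le k
  have hp0 : p ≠ 0 := (zero_lt_one.trans_le hp).ne'
  refine ⟨(M ^ (1 / p.toReal)).toReal, fun f h A c hA hc hf hh hfh => ?_⟩
  rw [discNorm_eq_iSup k p hf.continuousOn, discNorm_eq_iSup k p hh.continuousOn]
  refine iSup_le fun r => ?_
  have hhm := hh.continuousOn.aestronglyMeasurable_discMeasure k r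
  calc eLpNorm f p (discMeasure k r)
      ≤ eLpNorm ((fun z => A * ‖h z‖) + fun _ => c) p (discMeasure k r) := by
        refine eLpNorm_mono_ae_real ?_
        filter_upwards [ae_mem_ball_discMeasure k r] with z hz using hfh z hz
    _ ≤ eLpNorm (A • fun z => ‖h z‖) p (discMeasure k r) +
          eLpNorm (fun _ => c) p (discMeasure k r) :=
        eLpNorm_add_le (hhm.norm.const_smul A) aestronglyMeasurable_const hp
    _ ≤ _ := by
        rw [eLpNorm_const_smul, eLpNorm_norm, eLpNorm_const' c hp0 hp',
          Real.enorm_of_nonneg hA, Real.enorm_of_nonneg hc, ENNReal.ofReal_mul hc,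
          ENNReal.ofReal_toReal (ENNReal.rpow_ne_top_of_nonneg (by positivity) hM)]
        gcongr
        · exact le_iSup (fun r => eLpNorm h p (discMeasure k r)) r
        · exact hMr r

namespace DiscSpace

variable {k : DiscSpaceKind} {p : ℝ≥0∞} [hp : Fact (1 ≤ p)]

theorem exists_norm_le_add (k : DiscSpaceKind) (p : ℝ≥0∞) [hp : Fact (1 ≤ p)] (hp' : p ≠ ∞) :
    ∃ M : ℝ, 0 ≤ M ∧ ∀ (f h : DiscSpace k p) (A c : ℝ), 0 ≤ A → 0 ≤ c →
      (∀ z ∈ Metric.ball (0 : ℂ) 1, ‖f z‖ ≤ A * ‖h z‖ + c) → ‖f‖ ≤ A * ‖h‖ + c * M := by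
  obtain ⟨M, hM⟩ := exists_discNorm_le_add k hp.out hp'
  refine ⟨|M|, abs_nonneg M, fun f h A c hA hc hfh => ?_⟩
  have h1 := hM f h A c hA hc f.differentiableOn h.differentiableOn hfh
  have h2 : ENNReal.ofReal (c * M) ≤ ENNReal.ofReal (c * |M|) :=
    ENNReal.ofReal_le_ofReal (mul_le_mul_of_nonneg_left (le_abs_self M) hc)
  rw [← ofReal_norm, ← ofReal_norm, ← ENNReal.ofReal_mul hA] at h1
  replace h1 := h1.trans (add_le_add_right h2 _)
  have h3 : 0 ≤ A * ‖h‖ + c * |M| := by positivity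
  rwa [← ENNReal.ofReal_add (by positivity) (by positivity),
    ENNReal.ofReal_le_ofReal_iff h3] at h1

/-- A bounded analytic function on the disc, as an element of the space. -/
noncomputable def ofBounded (k : DiscSpaceKind) (p : ℝ≥0∞) [hp : Fact (1 ≤ p)] (hp' : p ≠ ∞)
    (f : ℂ → ℂ) (hf : DifferentiableOn ℂ f (Metric.ball 0 1))
    (hb : ∃ c, ∀ z ∈ Metric.ball (0 : ℂ) 1, ‖f z‖ ≤ c) : DiscSpace k p :=
  ⟨(Metric.ball 0 1).indicator f, by
    have hd : DifferentiableOn ℂ ((Metric.ball 0 1).indicator f) (Metric.ball 0 1) :=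
      hf.congr fun z hz => indicator_of_mem hz f
    refine ⟨hd, fun z hz => indicator_of_notMem hz f, ?_⟩
    obtain ⟨M, hM⟩ := exists_discNorm_le_add k hp.out hp'
    obtain ⟨c, hc⟩ := hb
    have hc0 : 0 ≤ c := (norm_nonneg _).trans (hc 0 (by simp))
    refine (hM _ 0 0 c le_rfl hc0 hd (differentiableOn_const 0) fun z hz => ?_).trans_lt
      (by simp [discNorm_zero])
    rw [indicator_of_mem hz, zero_mul, zero_add]
    exact hc z hz⟩

theorem ofBounded_apply (hp' : p ≠ ∞) {f : ℂ → ℂ} (hf : DifferentiableOn ℂ f (Metric.ball 0 1))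
    (hb : ∃ c, ∀ z ∈ Metric.ball (0 : ℂ) 1, ‖f z‖ ≤ c) {z : ℂ} (hz : z ∈ Metric.ball (0 : ℂ) 1) :
    ofBounded k p hp' f hf hb z = f z := indicator_of_mem hz f

/-- A sequence of bounded unit vectors that tends to zero uniformly off every neighbourhood
of `ξ`. -/
structure IsPeaking (ξ : ℂ) (f : ℕ → DiscSpace k p) : Prop where
  norm_eq_one : ∀ n, ‖f n‖ = 1
  bounded : ∀ n, ∃ B, ∀ z, ‖f n z‖ ≤ B
  eventually_le : ∀ δ > 0, ∀ η > 0, ∀ᶠ n in atTop, ∀ z ∈ Metric.ball (0 : ℂ) 1,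
    δ ≤ dist z ξ → ‖f n z‖ ≤ η

/-- Parallelogram law: |1 + v|² = 2 + 2|v|² - |1 - v|² ≤ 4 - δ². -/
theorem norm_half_one_add_le {v : ℂ} (hv : ‖v‖ ≤ 1) {δ : ℝ} (hδ : 0 ≤ δ) (h : δ ≤ ‖1 - v‖) :
    ‖(1 + v) / 2‖ ≤ √(1 - δ ^ 2 / 4) := by
  refine Real.le_sqrt_of_sq_le ?_
  have h1 := parallelogram_law_with_norm ℝ (1 : ℂ) v
  rw [norm_one] at h1
  rw [norm_div, Complex.norm_ofNat, div_pow]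
  nlinarith [norm_nonneg v, norm_nonneg (1 - v)]

/-- With w(z) = (1 + ξ̄z)/2, the powers wⁿ are at most qⁿ at distance δ or more from ξ, with q < 1.
Evaluation at an interior point where w = a > q shows that ‖wⁿ‖ is at least of order aⁿ, so the
normalized powers are O((q/a)ⁿ) there. -/
theorem exists_isPeaking (k : DiscSpaceKind) (p : ℝ≥0∞) [hp : Fact (1 ≤ p)] (hp' : p ≠ ∞)
    {ξ : ℂ} (hξ : ‖ξ‖ = 1) : ∃ f : ℕ → DiscSpace k p, IsPeaking ξ f := by
  set w : ℂ → ℂ := fun z => (1 + starRingEnd ℂ ξ * z) / 2 with hw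
  have hwd : Differentiable ℂ w := by fun_prop
  have hw1 : ∀ z ∈ Metric.ball (0 : ℂ) 1, ‖w z‖ ≤ 1 := by
    intro z hz
    have hz1 : ‖z‖ < 1 := by simpa using hz
    have := norm_half_one_add_le (v := starRingEnd ℂ ξ * z) (δ := 0) (by simp [hξ, hz1.le]) le_rfl
      (norm_nonneg _)
    simpa [hw] using this
  let W : ℕ → DiscSpace k p := fun n => ofBounded k p hp' (fun z => w z ^ n)
    (hwd.pow n).differentiableOn ⟨1, fun z hz => by
      rw [norm_pow]; exact pow_le_one₀ (norm_nonneg _) (hw1 z hz)⟩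
  have hW : ∀ n, ∀ z ∈ Metric.ball (0 : ℂ) 1, W n z = w z ^ n := fun n z hz =>
    ofBounded_apply hp' _ _ hz
  have hW0 : ∀ n, 0 < ‖W n‖ := by
    intro n
    rw [norm_pos_iff]
    intro h
    have h1 := hW n 0 (by simp)
    have h2 : W n 0 = 0 := by rw [h]; rfl
    rw [h2] at h1
    simp [hw] at h1
    exact pow_ne_zero n two_ne_zero h1.symm
  have hf : ∀ n z, (((‖W n‖⁻¹ : ℝ) : ℂ) • W n) z = ((‖W n‖⁻¹ : ℝ) : ℂ) * W n z :=
    fun n z => rfl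
  refine ⟨fun n => ((‖W n‖⁻¹ : ℝ) : ℂ) • W n, fun n => ?_, fun n => ?_, fun δ hδ η hη => ?_⟩
  · rw [norm_smul, Complex.norm_real, norm_inv, norm_norm, inv_mul_cancel₀ (hW0 n).ne']
  · refine ⟨‖W n‖⁻¹, fun z => ?_⟩
    rw [hf, norm_mul, Complex.norm_real, norm_inv, norm_norm]
    refine mul_le_of_le_one_right (by positivity) ?_
    by_cases hz : z ∈ Metric.ball (0 : ℂ) 1
    · rw [hW n z hz, norm_pow]
      exact pow_le_one₀ (norm_nonneg _) (hw1 z hz)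
    · rw [(W n).2.2.1 z hz]
      simp
  · set q := √(1 - δ ^ 2 / 4) with hq
    have hq1 : q < 1 := by
      rw [hq, Real.sqrt_lt' one_pos]
      nlinarith
    -- The point of the ray through ξ with w = a is (2a - 1)ξ; a > 1/2 makes its modulus 2a - 1.
    obtain ⟨a, ha, ha1⟩ := exists_between (max_lt hq1 (by norm_num : (1 / 2 : ℝ) < 1))
    have haq : q < a := (le_max_left _ _).trans_lt ha
    have ha2 : 1 / 2 < a := (le_max_right _ _).trans_lt ha
    obtain ⟨C, hC⟩ := exists_norm_apply_le k p (R := 2 * a - 1) (by linarith)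
    set z₀ : ℂ := ((2 * a - 1 : ℝ) : ℂ) * ξ with hz₀
    have hz₀n : ‖z₀‖ = 2 * a - 1 := by
      rw [hz₀, norm_mul, hξ, Complex.norm_real, mul_one, Real.norm_of_nonneg (by linarith)]
    have hz₀w : w z₀ = a := by
      have h1 : starRingEnd ℂ ξ * ξ = 1 := by
        rw [mul_comm, Complex.mul_conj, Complex.normSq_eq_norm_sq, hξ]; simp
      rw [hw, hz₀]
      simp only
      rw [mul_left_comm, h1]
      push_cast
      ring
    have ha0 : 0 < a := by linarith
    have hlow : ∀ n, a ^ n ≤ C * ‖W n‖ := by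
      intro n
      have h1 := hC (W n) z₀ hz₀n.le
      rw [hW n z₀ (by rw [mem_ball_zero_iff, hz₀n]; linarith), hz₀w, norm_pow,
        Complex.norm_real, Real.norm_of_nonneg ha0.le] at h1
      exact h1
    have hlim : Tendsto (fun n => C * (q / a) ^ n) atTop (𝓝 (C * 0)) :=
      (tendsto_pow_atTop_nhds_zero_of_lt_one (by positivity)
        ((div_lt_one ha0).2 haq)).const_mul C
    rw [mul_zero] at hlim
    filter_upwards [hlim.eventually (gt_mem_nhds hη)] with n hn z hz hzξ
    refine le_trans ?_ hn.le
    rw [hf, norm_mul, Complex.norm_real, norm_inv, norm_norm, hW n z hz, norm_pow]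
    have hz1 : ‖z‖ < 1 := by simpa using hz
    have hwq : ‖w z‖ ≤ q := by
      refine norm_half_one_add_le (by simp [hξ, hz1.le]) hδ.le (hzξ.trans_eq ?_)
      have h1 : 1 - starRingEnd ℂ ξ * z = starRingEnd ℂ ξ * (ξ - z) := by
        rw [mul_sub, mul_comm _ ξ, Complex.mul_conj, Complex.normSq_eq_norm_sq, hξ]; simp
      rw [h1, norm_mul, RCLike.norm_conj, hξ, one_mul, dist_comm, dist_eq_norm]
    have h2 : ‖w z‖ ^ n ≤ q ^ n := pow_le_pow_left₀ (norm_nonneg _) hwq n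
    rw [div_pow, inv_mul_eq_div, div_le_iff₀ (hW0 n), mul_comm C, mul_assoc]
    refine h2.trans ?_
    rw [div_mul_eq_mul_div, le_div_iff₀ (by positivity)]
    exact mul_le_mul_of_nonneg_left (hlow n) (by positivity)

/-- In fact g f_n - g(ξ) f_n → 0 in norm: near ξ by continuity of `g`, elsewhere because f_n is
uniformly small. -/
theorem IsPeaking.tendsto_norm_mulOp {ξ : ℂ} (hξ : ‖ξ‖ = 1) {f : ℕ → DiscSpace k p}
    (hf : IsPeaking ξ f) (hp' : p ≠ ∞) (g : DiscAlgebra) :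
    Tendsto (fun n => ‖mulOp k p g (f n)‖) atTop (𝓝 ‖g ξ‖) := by
  obtain ⟨M, hM0, hM⟩ := exists_norm_le_add k p hp'
  have hgc : ContinuousOn g (Metric.closedBall (0 : ℂ) 1) := by
    rw [← closure_ball (0 : ℂ) one_ne_zero]
    exact g.diffContOnCl.continuousOn
  have hs0 : 0 ≤ g.supNorm :=
    (norm_nonneg _).trans (g.norm_le_supNorm (Metric.mem_ball_self one_pos))
  have hlim : Tendsto (fun n => mulOp k p g (f n) - g ξ • f n) atTop (𝓝 0) := by
    refine Metric.tendsto_nhds.2 fun ε hε => ?_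
    obtain ⟨δ, hδ, hgδ⟩ := Metric.continuousOn_iff.1 hgc ξ (by simp [hξ]) (ε / 4) (by positivity)
    set L := (g.supNorm + ‖g ξ‖) * M + 1 with hL
    have hL0 : 0 < L := by positivity
    filter_upwards [hf.eventually_le δ hδ (ε / (4 * L)) (by positivity)] with n hn
    rw [dist_zero_right]
    have h1 := hM (mulOp k p g (f n) - g ξ • f n) (f n) (ε / 4)
      ((g.supNorm + ‖g ξ‖) * (ε / (4 * L))) (by positivity) (by positivity) fun z hz => ?_
    · rw [hf.norm_eq_one n, mul_one] at h1
      have h2 : (g.supNorm + ‖g ξ‖) * (ε / (4 * L)) * M ≤ ε / 4 := by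
        rw [mul_div_assoc', div_mul_eq_mul_div, div_le_div_iff₀ (by positivity) (by positivity)]
        nlinarith
      linarith
    · have h3 : (mulOp k p g (f n) - g ξ • f n) z = (g z - g ξ) * f n z := by
        rw [sub_mul]; rfl
      rw [h3, norm_mul]
      rcases lt_or_ge (dist z ξ) δ with hzδ | hzδ
      · have h4 := (hgδ z (Metric.ball_subset_closedBall hz) hzδ).le
        rw [dist_eq_norm] at h4
        exact (mul_le_mul_of_nonneg_right h4 (norm_nonneg _)).trans
          (le_add_of_nonneg_right (by positivity))
      · refine le_trans ?_ (le_add_of_nonneg_left (by positivity))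
        exact mul_le_mul ((norm_sub_le _ _).trans (add_le_add_left (g.norm_le_supNorm hz) _))
          (hn z hz hzδ) (norm_nonneg _) (by positivity)
  rw [tendsto_iff_norm_sub_tendsto_zero]
  refine squeeze_zero (fun _ => norm_nonneg _) (fun n => ?_)
    (tendsto_zero_iff_norm_tendsto_zero.1 hlim)
  have h1 := abs_norm_sub_norm_le (mulOp k p g (f n)) (g ξ • f n)
  rwa [norm_smul, hf.norm_eq_one n, mul_one] at h1

end DiscSpace

/-! ### Peaking sequences are weakly null -/

theorem eLpNorm_rpow_eq_add_compl {Ω E : Type*} [MeasurableSpace Ω] [NormedAddCommGroup E]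
    {μ : Measure Ω} {p : ℝ≥0∞} (hp0 : p ≠ 0) (hp' : p ≠ ∞) (f : Ω → E) {s : Set Ω}
    (hs : MeasurableSet s) : eLpNorm f p μ ^ p.toReal =
      eLpNorm f p (μ.restrict s) ^ p.toReal + eLpNorm f p (μ.restrict sᶜ) ^ p.toReal := by
  have h0 : p.toReal ≠ 0 := (ENNReal.toReal_pos hp0 hp').ne'
  simp only [eLpNorm_eq_lintegral_rpow_enorm_toReal hp0 hp', ← ENNReal.rpow_mul,
    one_div, inv_mul_cancel₀ h0, ENNReal.rpow_one]
  exact (lintegral_add_compl _ hs).symm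

theorem exists_pos_one_add_rpow_add_rpow_le {A q : ℝ} (hq : 0 < q) :
    ∃ x > 0, (1 + x) ^ q + (A + x) ^ q ≤ A ^ q + 2 := by
  have hc : ContinuousAt (fun x : ℝ => (1 + x) ^ q + (A + x) ^ q) 0 := by
    refine ContinuousAt.add (ContinuousAt.rpow_const (by fun_prop) (Or.inr hq.le))
      (ContinuousAt.rpow_const (by fun_prop) (Or.inr hq.le))
  have h1 : (1 + (0 : ℝ)) ^ q + (A + 0) ^ q < A ^ q + 2 := by
    rw [add_zero, add_zero, Real.one_rpow]
    linarith
  have h2 : ∀ᶠ x in 𝓝[>] (0 : ℝ), (1 + x) ^ q + (A + x) ^ q < A ^ q + 2 :=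
    (hc.eventually (gt_mem_nhds h1)).filter_mono nhdsWithin_le_nhds
  obtain ⟨x, hx, hx0⟩ := (h2.and self_mem_nhdsWithin).exists
  exact ⟨x, hx0, hx.le⟩

theorem ENNReal.exists_pos_mul_rpow_le {B x q : ℝ} (hx : 0 < x) (hq : 0 < q) :
    ∃ ε : ℝ≥0∞, 0 < ε ∧ ENNReal.ofReal B * ε ^ q ≤ ENNReal.ofReal x := by
  have h : Tendsto (fun ε : ℝ≥0∞ => ENNReal.ofReal B * ε ^ q) (𝓝[>] 0)
      (𝓝 (ENNReal.ofReal B * 0)) := by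
    refine ENNReal.Tendsto.const_mul ?_ (Or.inr ENNReal.ofReal_ne_top)
    have := (ENNReal.continuous_rpow_const (y := q)).tendsto 0
    rw [ENNReal.zero_rpow_of_pos hq] at this
    exact this.mono_left nhdsWithin_le_nhds
  rw [mul_zero] at h
  obtain ⟨ε, hε, h0⟩ := ((h.eventually (gt_mem_nhds (ENNReal.ofReal_pos.2 hx))).and
    self_mem_nhdsWithin).exists
  exact ⟨ε, h0, hε.le⟩

namespace DiscSpace

variable {k : DiscSpaceKind} {p : ℝ≥0∞} [hp : Fact (1 ≤ p)]

theorem eLpNorm_le_ofReal_norm (f : DiscSpace k p) (r : Ico (0 : ℝ) 1) :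
    eLpNorm f p (discMeasure k r) ≤ ENNReal.ofReal ‖f‖ := by
  rw [ofReal_norm, discNorm_eq_iSup k p f.differentiableOn.continuousOn]
  exact le_iSup (fun r => eLpNorm f p (discMeasure k r)) r

theorem norm_le_of_eLpNorm_le {f : DiscSpace k p} {c : ℝ} (hc : 0 ≤ c)
    (h : ∀ r, eLpNorm f p (discMeasure k r) ≤ ENNReal.ofReal c) : ‖f‖ ≤ c := by
  rw [← ENNReal.ofReal_le_ofReal_iff hc, ofReal_norm,
    discNorm_eq_iSup k p f.differentiableOn.continuousOn]
  exact iSup_le h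

/-- Near ξ the bounded function `h` has small norm, and away from ξ so does f_n, so the p-th powers
of the norms almost add up to ‖h‖^p + 1. The constant 2 leaves room for the errors. The index is
chosen before `a`, since `a` will later depend on f_n. -/
theorem IsPeaking.eventually_norm_add_rpow_le {ξ : ℂ} (hξ : ‖ξ‖ = 1) {f : ℕ → DiscSpace k p}
    (hf : IsPeaking ξ f) (hp' : p ≠ ∞) {h : DiscSpace k p} (hh : ∃ B, ∀ z, ‖h z‖ ≤ B) :
    ∀ᶠ n in atTop, ∀ a : ℂ, ‖a‖ = 1 → ‖h + a • f n‖ ^ p.toReal ≤ ‖h‖ ^ p.toReal + 2 := by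
  have hp0 : p ≠ 0 := (zero_lt_one.trans_le hp.out).ne'
  have hq : 0 < p.toReal := ENNReal.toReal_pos hp0 hp'
  obtain ⟨B, hB⟩ := hh
  have hB0 : 0 ≤ B := (norm_nonneg _).trans (hB 0)
  obtain ⟨M, hM, hMr⟩ := exists_discMeasure_univ_le k
  obtain ⟨x, hx, hxle⟩ := exists_pos_one_add_rpow_add_rpow_le (A := ‖h‖) hq
  have hq' : 0 < 1 / p.toReal := by positivity
  obtain ⟨ε, hε, hεx⟩ := ENNReal.exists_pos_mul_rpow_le (B := B) hx hq'
  obtain ⟨δ, hδ, hδr⟩ := exists_discMeasure_ball_le k hξ hε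
  obtain ⟨η, hη, hηx⟩ : ∃ η : ℝ, 0 < η ∧
      ENNReal.ofReal η * M ^ (1 / p.toReal) ≤ ENNReal.ofReal x := by
    have hM' : M ^ (1 / p.toReal) ≠ ∞ := ENNReal.rpow_ne_top_of_nonneg hq'.le hM
    set m := (M ^ (1 / p.toReal)).toReal with hm
    have hm0 : 0 ≤ m := ENNReal.toReal_nonneg
    refine ⟨x / (m + 1), by positivity, ?_⟩
    rw [← ENNReal.ofReal_toReal hM', ← ENNReal.ofReal_mul (by positivity)]
    refine ENNReal.ofReal_le_ofReal ?_
    rw [← hm, div_mul_eq_mul_div, div_le_iff₀ (by positivity)]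
    nlinarith
  filter_upwards [hf.eventually_le δ hδ η hη] with n hn a ha
  set S := Metric.ball ξ δ with hS
  have hSm : MeasurableSet S := measurableSet_ball
  have hhm := fun r => h.differentiableOn.continuousOn.aestronglyMeasurable_discMeasure k r
  have hfm := fun r => (a • f n).differentiableOn.continuousOn.aestronglyMeasurable_discMeasure k r
  have hafn : ∀ z, ‖(a • f n) z‖ = ‖f n z‖ := fun z => by
    change ‖a * f n z‖ = _
    rw [norm_mul, ha, one_mul]
  have key : ∀ r, eLpNorm (h + a • f n) p (discMeasure k r) ^ p.toReal ≤
      ENNReal.ofReal (‖h‖ ^ p.toReal + 2) := by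
    intro r
    rw [eLpNorm_rpow_eq_add_compl hp0 hp' _ hSm]
    have h1 : eLpNorm (h + a • f n) p ((discMeasure k r).restrict S) ≤ ENNReal.ofReal (1 + x) := by
      refine (eLpNorm_add_le (hhm r).restrict (hfm r).restrict hp.out).trans ?_
      rw [add_comm, ENNReal.ofReal_add zero_le_one hx.le]
      refine add_le_add ?_ ?_
      · refine (eLpNorm_restrict_le _ _ _ _).trans ((eLpNorm_le_ofReal_norm _ r).trans_eq ?_)
        rw [norm_smul, ha, hf.norm_eq_one, one_mul]
      · refine (eLpNorm_le_of_ae_bound (C := B) (Eventually.of_forall hB)).trans ?_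
        rw [Measure.restrict_apply_univ, mul_comm]
        refine le_trans ?_ hεx
        rw [← one_div]
        exact mul_le_mul_right (ENNReal.rpow_le_rpow (hδr r) hq'.le) _
    have h2 : eLpNorm (h + a • f n) p ((discMeasure k r).restrict Sᶜ) ≤
        ENNReal.ofReal (‖h‖ + x) := by
      refine (eLpNorm_add_le (hhm r).restrict (hfm r).restrict hp.out).trans ?_
      rw [ENNReal.ofReal_add (norm_nonneg _) hx.le]
      refine add_le_add ?_ ?_
      · exact (eLpNorm_restrict_le _ _ _ _).trans (eLpNorm_le_ofReal_norm _ r)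
      · refine (eLpNorm_le_of_ae_bound (C := η) ?_).trans ?_
        · filter_upwards [ae_restrict_mem hSm.compl,
            ae_restrict_of_ae (ae_mem_ball_discMeasure k r)] with z hz hzb
          rw [hafn]
          exact hn z hzb (by simpa [hS] using hz)
        · rw [mul_comm, ← one_div]
          refine le_trans ?_ hηx
          refine mul_le_mul_right (ENNReal.rpow_le_rpow ?_ hq'.le) _
          exact (measure_mono (subset_univ _)).trans
            ((Measure.restrict_apply_le _ _).trans (hMr r))
    refine (add_le_add (ENNReal.rpow_le_rpow h1 hq.le) (ENNReal.rpow_le_rpow h2 hq.le)).trans ?_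
    rw [ENNReal.ofReal_rpow_of_pos (by positivity), ENNReal.ofReal_rpow_of_pos (by positivity),
      ← ENNReal.ofReal_add (by positivity) (by positivity)]
    exact ENNReal.ofReal_le_ofReal hxle
  have hfin : ‖h + a • f n‖ ≤ (‖h‖ ^ p.toReal + 2) ^ (p.toReal)⁻¹ := by
    refine norm_le_of_eLpNorm_le (by positivity) fun r => ?_
    rw [← ENNReal.ofReal_rpow_of_pos (by positivity)]
    exact (ENNReal.le_rpow_inv_iff hq).2 (key r)
  rwa [← Real.le_rpow_inv_iff_of_pos (norm_nonneg _) (by positivity) hq] 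

/-- If |φ(f_n)| ≥ ε infinitely often, adding such vectors with phases that make φ positive gives `h`
with ‖h‖^p ≤ 2N and Re φ(h) ≥ Nε. Then N^(p-1) stays bounded, contradicting p > 1. -/
theorem IsPeaking.isUnitWeaklyNull {ξ : ℂ} (hξ : ‖ξ‖ = 1) {f : ℕ → DiscSpace k p}
    (hf : IsPeaking ξ f) (hp1 : 1 < p) (hp' : p ≠ ∞) : IsUnitWeaklyNull f := by
  refine ⟨hf.norm_eq_one, fun φ => ?_⟩
  by_contra hφ
  have hq : 1 < p.toReal := by
    rw [← ENNReal.toReal_one]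
    exact (ENNReal.toReal_lt_toReal ENNReal.one_ne_top hp').2 hp1
  obtain ⟨ε, hε, hfr⟩ : ∃ ε > 0, ∃ᶠ n in atTop, ε ≤ ‖φ (f n)‖ := by
    rw [Metric.tendsto_nhds] at hφ
    push Not at hφ
    obtain ⟨ε, hε, h⟩ := hφ
    exact ⟨ε, hε, by simpa using h⟩
  have hind : ∀ N : ℕ, ∃ h : DiscSpace k p, (∃ B, ∀ z, ‖h z‖ ≤ B) ∧
      ‖h‖ ^ p.toReal ≤ 2 * N ∧ N * ε ≤ (φ h).re := by
    intro N
    induction N with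
    | zero =>
      refine ⟨0, ⟨0, fun z => ?_⟩, ?_, ?_⟩
      · change ‖(0 : ℂ)‖ ≤ 0
        simp
      · simp [Real.zero_rpow (by linarith : p.toReal ≠ 0)]
      · simp
    | succ N ih =>
      obtain ⟨h, hB, hn, hφh⟩ := ih
      obtain ⟨n, hnε, hstep⟩ := (hfr.and_eventually
        (hf.eventually_norm_add_rpow_le hξ hp' hB)).exists
      have hne : φ (f n) ≠ 0 := norm_pos_iff.1 (hε.trans_le hnε)
      set a : ℂ := ‖φ (f n)‖ / φ (f n) with ha
      have ha1 : ‖a‖ = 1 := by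
        rw [ha, norm_div, Complex.norm_real, norm_norm, div_self (norm_ne_zero_iff.2 hne)]
      refine ⟨h + a • f n, ?_, ?_, ?_⟩
      · obtain ⟨B, hB⟩ := hB
        obtain ⟨B', hB'⟩ := hf.bounded n
        refine ⟨B + B', fun z => ?_⟩
        change ‖h z + a * f n z‖ ≤ _
        refine (norm_add_le _ _).trans (add_le_add (hB z) ?_)
        rw [norm_mul, ha1, one_mul]
        exact hB' z
      · have := hstep a ha1
        push_cast
        linarith
      · rw [map_add, map_smul, smul_eq_mul, ha, div_mul_cancel₀ _ hne, Complex.add_re,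
          Complex.ofReal_re]
        push_cast
        linarith
  have hbound : ∀ N : ℕ, 1 ≤ N → (N : ℝ) ^ (p.toReal - 1) ≤ 2 * ‖φ‖ ^ p.toReal / ε ^ p.toReal := by
    intro N hN
    obtain ⟨h, -, hn, hφh⟩ := hind N
    have hN0 : (0 : ℝ) < N := by exact_mod_cast hN
    have h1 : N * ε ≤ ‖φ‖ * ‖h‖ := hφh.trans ((Complex.re_le_norm _).trans (φ.le_opNorm h))
    have h2 := Real.rpow_le_rpow (by positivity) h1 (by linarith : 0 ≤ p.toReal)
    rw [Real.mul_rpow hN0.le hε.le, Real.mul_rpow (norm_nonneg _) (norm_nonneg _)] at h2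
    have h3 := h2.trans (mul_le_mul_of_nonneg_left hn (by positivity))
    rw [Real.rpow_sub hN0, Real.rpow_one, div_le_div_iff₀ hN0 (by positivity)]
    linarith
  have ht : Tendsto (fun N : ℕ => (N : ℝ) ^ (p.toReal - 1)) atTop atTop :=
    (tendsto_rpow_atTop (by linarith)).comp tendsto_natCast_atTop_atTop
  obtain ⟨N, hN, hN1⟩ := ((ht.eventually_gt_atTop _).and (eventually_ge_atTop 1)).exists
  exact absurd (hbound N hN1) hN.not_ge

end DiscSpace

/-! ### Strong integrals of operator families -/

section Operators

variable {X : Type*} [NormedAddCommGroup X] [NormedSpace ℂ X] {S : Ioo (0 : ℝ) 1 → X →L[ℂ] X}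

theorem SatisfiesW.stronglyMeasurable (hW : SatisfiesW S) (f : X) :
    StronglyMeasurable fun t => S t f :=
  (hW f).1.stronglyMeasurable

theorem SatisfiesW.integrable (hW : SatisfiesW S) (f : X) : Integrable fun t => S t f :=
  ⟨(hW.stronglyMeasurable f).aestronglyMeasurable, (hW f).2⟩

theorem lintegral_enorm_le_liminf_of_tendsto (hW : SatisfiesW S) {F : ℕ → X}
    {h : Ioo (0 : ℝ) 1 → ℝ≥0∞} (hF : ∀ᵐ t, Tendsto (fun n => ‖S t (F n)‖ₑ) atTop (𝓝 (h t))) :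
    ∫⁻ t, h t ≤ liminf (fun n => ∫⁻ t, ‖S t (F n)‖ₑ) atTop := by
  refine le_trans (lintegral_mono_ae ?_)
    (lintegral_liminf_le fun n => (hW.stronglyMeasurable (F n)).enorm)
  filter_upwards [hF] with t ht using ht.liminf_eq.ge

/-- The seminorm f ↦ ∫ ‖S_t f‖ dt is finite everywhere and lower semicontinuous by Fatou's lemma. On
a Banach space such a seminorm is continuous, by Baire's theorem. -/
theorem SatisfiesW.exists_lintegral_le [CompleteSpace X] (hW : SatisfiesW S) :
    ∃ C : ℝ, 0 ≤ C ∧ ∀ f, ∫⁻ t, ‖S t f‖ₑ ≤ ENNReal.ofReal (C * ‖f‖) := by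
  let q : Seminorm ℂ X := Seminorm.of (fun f => (∫⁻ t, ‖S t f‖ₑ).toReal)
    (fun f h => by
      rw [← ENNReal.toReal_add (hW f).2.ne (hW h).2.ne]
      refine ENNReal.toReal_mono (ENNReal.add_lt_top.2 ⟨(hW f).2, (hW h).2⟩).ne ?_
      rw [← lintegral_add_left (hW.stronglyMeasurable f).enorm]
      refine lintegral_mono fun t => ?_
      beta_reduce
      rw [map_add]
      exact enorm_add_le _ _)
    (fun c f => by
      simp_rw [map_smul, enorm_smul]
      rw [lintegral_const_mul' _ _ enorm_ne_top, ENNReal.toReal_mul, toReal_enorm])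
  have hq : ∀ f, q f = (∫⁻ t, ‖S t f‖ₑ).toReal := fun f => rfl
  have hqo : ∀ f, ∫⁻ t, ‖S t f‖ₑ = ENNReal.ofReal (q f) := fun f =>
    (ENNReal.ofReal_toReal (hW f).2.ne).symm
  have hlsc : LowerSemicontinuous q := by
    refine lowerSemicontinuous_iff_isClosed_preimage.2 fun y => ?_
    refine IsSeqClosed.isClosed fun F f hF hf => ?_
    have hy : 0 ≤ y := (apply_nonneg q (F 0)).trans (hF 0)
    have h1 := lintegral_enorm_le_liminf_of_tendsto hW (F := F) (h := fun t => ‖S t f‖ₑ)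
      (Eventually.of_forall fun t => (((S t).continuous.tendsto f).comp hf).enorm)
    change q f ≤ y
    rw [← ENNReal.ofReal_le_ofReal_iff hy, ← hqo]
    refine h1.trans (liminf_le_of_frequently_le' (Eventually.frequently ?_))
    refine Eventually.of_forall fun n => ?_
    rw [hqo]
    exact ENNReal.ofReal_le_ofReal (hF n)
  obtain ⟨C, hC, h⟩ := Seminorm.bound_of_continuous_normedSpace q
    (Seminorm.continuous_of_lowerSemicontinuous q hlsc)
  refine ⟨C, hC.le, fun f => ?_⟩
  rw [hqo]
  exact ENNReal.ofReal_le_ofReal (h f)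

theorem SatisfiesW.exists_isStrongIntegral [CompleteSpace X] (hW : SatisfiesW S) :
    ∃ T : X →L[ℂ] X, IsStrongIntegral S T := by
  obtain ⟨C, hC, h⟩ := hW.exists_lintegral_le
  refine ⟨LinearMap.mkContinuous
    { toFun := fun f => ∫ t, S t f
      map_add' := fun f₁ f₂ => by
        simp_rw [map_add]
        exact integral_add (hW.integrable f₁) (hW.integrable f₂)
      map_smul' := fun c f => by
        simp_rw [map_smul, RingHom.id_apply]
        exact integral_smul c _ } C fun f => ?_, fun f => rfl⟩
  have h1 := (enorm_integral_le_lintegral_enorm fun t => S t f).trans (h f)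
  rw [← ofReal_norm, ENNReal.ofReal_le_ofReal_iff (by positivity)] at h1
  exact h1

end Operators

/-! ### Norms of multiplication operators -/

namespace DiscAlgebra

theorem supNorm_nonneg (g : DiscAlgebra) : 0 ≤ g.supNorm :=
  (norm_nonneg _).trans (g.norm_le_supNorm (Metric.mem_ball_self one_pos))

theorem continuousOn_closedBall (g : DiscAlgebra) : ContinuousOn g (Metric.closedBall (0 : ℂ) 1) := by
  rw [← closure_ball (0 : ℂ) one_ne_zero]
  exact g.diffContOnCl.continuousOn

theorem norm_le_supNorm' (g : DiscAlgebra) {z : ℂ} (hz : ‖z‖ ≤ 1) : ‖g z‖ ≤ g.supNorm := by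
  have hz' : z ∈ closure (Metric.ball (0 : ℂ) 1) := by
    rw [closure_ball (0 : ℂ) one_ne_zero]
    simpa using hz
  exact le_on_closure (fun w hw => g.norm_le_supNorm hw) g.diffContOnCl.continuousOn.norm
    continuousOn_const hz'

theorem exists_norm_eq_supNorm (g : DiscAlgebra) : ∃ ξ : ℂ, ‖ξ‖ = 1 ∧ ‖g ξ‖ = g.supNorm := by
  obtain ⟨ξ, hξ, hmax⟩ := Complex.exists_mem_frontier_isMaxOn_norm
    (Metric.isBounded_ball (x := (0 : ℂ)) (r := 1)) ⟨0, by simp⟩ g.diffContOnCl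
  rw [frontier_ball (0 : ℂ) one_ne_zero, mem_sphere_zero_iff_norm] at hξ
  refine ⟨ξ, hξ, le_antisymm (g.norm_le_supNorm' hξ.le) ?_⟩
  have : Nonempty (Metric.ball (0 : ℂ) 1) := ⟨⟨0, by simp⟩⟩
  exact ciSup_le fun z => hmax (subset_closure z.2)

end DiscAlgebra

namespace DiscSpace

variable {k : DiscSpaceKind} {p : ℝ≥0∞} [hp : Fact (1 ≤ p)]

theorem enorm_mulOp_le (g : DiscAlgebra) : ‖mulOp k p g‖ₑ ≤ ENNReal.ofReal g.supNorm := by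
  rw [← _root_.ofReal_norm]
  exact ENNReal.ofReal_le_ofReal (LinearMap.mkContinuous_norm_le _ g.supNorm_nonneg _)

theorem le_weakNullMax_mulOp (hp1 : 1 < p) (hp' : p ≠ ∞) (g : DiscAlgebra) :
    ENNReal.ofReal g.supNorm ≤ weakNullMax (mulOp k p g) := by
  obtain ⟨ξ, hξ, hgξ⟩ := g.exists_norm_eq_supNorm
  obtain ⟨f, hf⟩ := exists_isPeaking k p hp' hξ
  refine le_trans (le_of_eq ?_) (le_iSup₂_of_le f (hf.isUnitWeaklyNull hξ hp1 hp') le_rfl)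
  have h := ENNReal.tendsto_ofReal (hf.tendsto_norm_mulOp hξ hp' g)
  simp only [_root_.ofReal_norm] at h
  rw [← hgξ, _root_.ofReal_norm, h.limsup_eq]

theorem norms_mulOp (hp1 : 1 < p) (hp' : p ≠ ∞) (g : DiscAlgebra) :
    weakNullMax (mulOp k p g) = ENNReal.ofReal g.supNorm ∧
    essNorm (mulOp k p g) = ENNReal.ofReal g.supNorm ∧
    ‖mulOp k p g‖ₑ = ENNReal.ofReal g.supNorm := by
  have h1 := le_weakNullMax_mulOp (k := k) hp1 hp' g
  have h2 := weakNullMax_le_essNorm (mulOp k p g)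
  have h3 := essNorm_le_enorm (mulOp k p g)
  have h4 := enorm_mulOp_le (k := k) (p := p) g
  exact ⟨le_antisymm (h2.trans (h3.trans h4)) h1, le_antisymm (h3.trans h4) (h1.trans h2),
    le_antisymm h4 (h1.trans (h2.trans h3))⟩

/-! ### The integrated symbol -/

variable {g : Ioo (0 : ℝ) 1 → DiscAlgebra}

theorem exists_eq_one (k : DiscSpaceKind) (p : ℝ≥0∞) [Fact (1 ≤ p)] (hp' : p ≠ ∞) :
    ∃ e : DiscSpace k p, ∀ z ∈ Metric.ball (0 : ℂ) 1, e z = 1 :=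
  ⟨ofBounded k p hp' (fun _ => 1) (differentiableOn_const 1) ⟨1, by simp⟩,
    fun _ hz => ofBounded_apply hp' _ _ hz⟩

theorem continuous_symbol (hp' : p ≠ ∞) (hW : SatisfiesW fun t => mulOp k p (g t)) {z : ℂ}
    (hz : z ∈ Metric.ball (0 : ℂ) 1) : Continuous fun t => g t z := by
  obtain ⟨e, he⟩ := exists_eq_one k p hp'
  refine ((eval k p z).continuous.comp (hW e).1).congr fun t => ?_
  change g t z * e z = g t z
  rw [he z hz, mul_one]

/-- Inside the disc t ↦ g_t(z) is continuous; a boundary value is a radial limit of such functions,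
which still gives measurability. -/
theorem stronglyMeasurable_symbol (hp' : p ≠ ∞) (hW : SatisfiesW fun t => mulOp k p (g t)) {z : ℂ}
    (hz : ‖z‖ ≤ 1) : StronglyMeasurable fun t => g t z := by
  have hr : Tendsto (fun n : ℕ => ((1 - 1 / ((n : ℝ) + 1) : ℝ) : ℂ) * z) atTop (𝓝 z) := by
    have h1 : Tendsto (fun n : ℕ => (1 - 1 / ((n : ℝ) + 1) : ℝ)) atTop (𝓝 (1 - 0)) :=
      tendsto_const_nhds.sub tendsto_one_div_add_atTop_nhds_zero_nat
    have h2 := ((Complex.continuous_ofReal.tendsto _).comp h1).mul_const z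
    simpa using h2
  have hmem : ∀ n : ℕ, ((1 - 1 / ((n : ℝ) + 1) : ℝ) : ℂ) * z ∈ Metric.ball (0 : ℂ) 1 := by
    intro n
    have h0 : 0 < 1 / ((n : ℝ) + 1) := by positivity
    have h1 : 1 / ((n : ℝ) + 1) ≤ 1 := by
      rw [div_le_one (by positivity)]
      linarith [(Nat.cast_nonneg n : (0 : ℝ) ≤ n)]
    rw [mem_ball_zero_iff, norm_mul, Complex.norm_real, Real.norm_of_nonneg (by linarith)]
    nlinarith [norm_nonneg z]
  refine stronglyMeasurable_of_tendsto atTop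
    (fun n => (continuous_symbol hp' hW (hmem n)).stronglyMeasurable) (tendsto_pi_nhds.2 fun t => ?_)
  refine ((g t).continuousOn_closedBall z (by simpa using hz)).tendsto.comp
    (tendsto_nhdsWithin_iff.2 ⟨hr, Eventually.of_forall fun n =>
      Metric.ball_subset_closedBall (hmem n)⟩)

/-- The supremum is over uncountably many points, so measurability comes from lower semicontinuity.
-/
theorem measurable_supNorm (hp' : p ≠ ∞) (hW : SatisfiesW fun t => mulOp k p (g t)) :
    Measurable fun t => (g t).supNorm := by
  refine LowerSemicontinuous.measurable (lowerSemicontinuous_ciSup (fun t => ?_)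
    fun z => (continuous_symbol hp' hW z.2).norm.lowerSemicontinuous)
  exact ⟨(g t).supNorm, by rintro _ ⟨w, rfl⟩; exact (g t).norm_le_supNorm w.2⟩

theorem integrable_supNorm (hp' : p ≠ ∞) (hW : SatisfiesW fun t => mulOp k p (g t))
    (hI : ∫⁻ t, ENNReal.ofReal (g t).supNorm ≠ ∞) : Integrable fun t => (g t).supNorm := by
  refine ⟨(measurable_supNorm hp' hW).aestronglyMeasurable, ?_⟩
  rw [hasFiniteIntegral_iff_ofReal (Eventually.of_forall fun t => (g t).supNorm_nonneg)]
  exact hI.lt_top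

theorem integrable_symbol (hp' : p ≠ ∞) (hW : SatisfiesW fun t => mulOp k p (g t))
    (hI : ∫⁻ t, ENNReal.ofReal (g t).supNorm ≠ ∞) {z : ℂ} (hz : ‖z‖ ≤ 1) :
    Integrable fun t => g t z :=
  (integrable_supNorm hp' hW hI).mono' (stronglyMeasurable_symbol hp' hW hz).aestronglyMeasurable
    (Eventually.of_forall fun t => (g t).norm_le_supNorm' hz)

theorem strongIntegral_apply (hW : SatisfiesW fun t => mulOp k p (g t))
    {T : DiscSpace k p →L[ℂ] DiscSpace k p} (hT : IsStrongIntegral (fun t => mulOp k p (g t)) T)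
    (f : DiscSpace k p) (z : ℂ) : T f z = (∫ t, g t z) * f z := by
  rw [← eval_apply z (T f), hT f, ← (eval k p z).integral_comp_comm (hW.integrable f),
    ← integral_mul_const]
  rfl

/-- Analyticity of the integrated symbol is read off from `T` applied to the constant 1; continuity
up to the boundary is dominated convergence with majorant ‖g_t‖_∞. -/
theorem exists_strongIntegral_eq_mulOp (hp' : p ≠ ∞) (hW : SatisfiesW fun t => mulOp k p (g t))
    (hI : ∫⁻ t, ENNReal.ofReal (g t).supNorm ≠ ∞)
    {T : DiscSpace k p →L[ℂ] DiscSpace k p} (hT : IsStrongIntegral (fun t => mulOp k p (g t)) T) :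
    ∃ G : DiscAlgebra, T = mulOp k p G ∧ ∀ z, G z = ∫ t, g t z := by
  obtain ⟨e, he⟩ := exists_eq_one k p hp'
  have hd : DifferentiableOn ℂ (fun z => ∫ t, g t z) (Metric.ball 0 1) := by
    refine (T e).differentiableOn.congr fun z hz => ?_
    rw [strongIntegral_apply hW hT, he z hz, mul_one]
  have hc : ContinuousOn (fun z => ∫ t, g t z) (Metric.closedBall 0 1) := by
    refine continuousOn_of_dominated (bound := fun t => (g t).supNorm) (fun z hz => ?_)
      (fun z hz => ?_) (integrable_supNorm hp' hW hI) ?_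
    · exact (stronglyMeasurable_symbol hp' hW (by simpa using hz)).aestronglyMeasurable
    · exact Eventually.of_forall fun t => (g t).norm_le_supNorm' (by simpa using hz)
    · exact Eventually.of_forall fun t => (g t).continuousOn_closedBall
  rw [← closure_ball (0 : ℂ) one_ne_zero] at hc
  refine ⟨⟨fun z => ∫ t, g t z, hd, hc⟩, ?_, fun z => rfl⟩
  ext f
  exact Subtype.ext (funext fun z => strongIntegral_apply hW hT f z)

/-- Along unit vectors peaking at ξ, ‖g_t f_n‖ → |g_t(ξ)| = ‖g_t‖_∞ for almost every t, while ∫ ‖g_t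
f_n‖ dt ≤ C. Fatou's lemma concludes. -/
theorem lintegral_supNorm_ne_top (hp' : p ≠ ∞) (hW : SatisfiesW fun t => mulOp k p (g t))
    {ξ : ℂ} (hξ : ‖ξ‖ = 1) (hg : ∀ᵐ t, ‖g t ξ‖ = (g t).supNorm) :
    ∫⁻ t, ENNReal.ofReal (g t).supNorm ≠ ∞ := by
  obtain ⟨f, hf⟩ := exists_isPeaking k p hp' hξ
  obtain ⟨C, hC, h⟩ := hW.exists_lintegral_le
  have h1 : ∫⁻ t, ENNReal.ofReal (g t).supNorm ≤
      liminf (fun n => ∫⁻ t, ‖mulOp k p (g t) (f n)‖ₑ) atTop := by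
    refine lintegral_enorm_le_liminf_of_tendsto hW ?_
    filter_upwards [hg] with t ht
    have h2 := ENNReal.tendsto_ofReal (hf.tendsto_norm_mulOp hξ hp' (g t))
    rw [ht] at h2
    simpa only [_root_.ofReal_norm] using h2
  have h3 : liminf (fun n => ∫⁻ t, ‖mulOp k p (g t) (f n)‖ₑ) atTop ≤ ENNReal.ofReal C := by
    refine liminf_le_of_frequently_le' (Eventually.frequently (Eventually.of_forall fun n => ?_))
    refine (h (f n)).trans_eq ?_
    rw [hf.norm_eq_one n, mul_one]
  exact ((h1.trans h3).trans_lt ENNReal.ofReal_lt_top).ne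

theorem ofReal_integral_supNorm (hp' : p ≠ ∞) (hW : SatisfiesW fun t => mulOp k p (g t))
    (hI : ∫⁻ t, ENNReal.ofReal (g t).supNorm ≠ ∞) :
    ENNReal.ofReal (∫ t, (g t).supNorm) = ∫⁻ t, ENNReal.ofReal (g t).supNorm :=
  ofReal_integral_eq_lintegral_ofReal (integrable_supNorm hp' hW hI)
    (Eventually.of_forall fun t => (g t).supNorm_nonneg)

theorem supNorm_le_integral_supNorm (hp' : p ≠ ∞) (hW : SatisfiesW fun t => mulOp k p (g t))
    (hI : ∫⁻ t, ENNReal.ofReal (g t).supNorm ≠ ∞) {G : DiscAlgebra}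
    (hG : ∀ z, G z = ∫ t, g t z) : G.supNorm ≤ ∫ t, (g t).supNorm := by
  obtain ⟨ξ, hξ, hGξ⟩ := G.exists_norm_eq_supNorm
  rw [← hGξ, hG]
  exact norm_integral_le_of_norm_le (integrable_supNorm hp' hW hI)
    (Eventually.of_forall fun t => (g t).norm_le_supNorm' hξ.le)

end DiscSpace

/-! ### Equality case of the triangle inequality -/

theorem Complex.exists_circle_mul_eq_norm (c : ℂ) : ∃ θ : Circle, (θ : ℂ) * c = ‖c‖ := by
  rcases eq_or_ne c 0 with rfl | hc
  · exact ⟨1, by simp⟩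
  · refine ⟨⟨‖c‖ / c, ?_⟩, div_mul_cancel₀ _ hc⟩
    refine mem_sphere_zero_iff_norm.2 ?_
    rw [norm_div, Complex.norm_real, norm_norm, div_self (norm_ne_zero_iff.2 hc)]

theorem Complex.eq_ofReal_of_norm_le_of_le_re {w : ℂ} {s : ℝ} (h1 : ‖w‖ ≤ s) (h2 : s ≤ w.re) :
    w = s := by
  have h3 : w.re = ‖w‖ := le_antisymm (Complex.re_le_norm w) (h1.trans h2)
  have h4 : w.re = s := le_antisymm ((Complex.re_le_norm w).trans h1) h2
  have h5 := Complex.sq_norm w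
  rw [Complex.normSq_apply, ← h3] at h5
  have h6 : w.im = 0 := by
    have : w.im * w.im = 0 := by linarith
    simpa using this
  exact Complex.ext (by simpa using h4) (by simpa using h6)

namespace DiscSpace

variable {k : DiscSpaceKind} {p : ℝ≥0∞} [hp : Fact (1 ≤ p)] {g : Ioo (0 : ℝ) 1 → DiscAlgebra}

/-- Take ξ where |G| is maximal and rotate G(ξ) to be nonnegative. Then ‖g_t‖_∞ - Re(θ g_t(ξ)) is
nonnegative with zero integral, hence zero almost everywhere, and |θ g_t(ξ)| ≤ ‖g_t‖_∞ leaves no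
imaginary part. -/
theorem exists_ae_eq_supNorm (hp' : p ≠ ∞) (hW : SatisfiesW fun t => mulOp k p (g t))
    (hI : ∫⁻ t, ENNReal.ofReal (g t).supNorm ≠ ∞) {G : DiscAlgebra}
    (hG : ∀ z, G z = ∫ t, g t z) (hle : ∫ t, (g t).supNorm ≤ G.supNorm) :
    ∃ ξ θ : Circle, ∀ᵐ t, (θ : ℂ) * g t (ξ : ℂ) = ((g t).supNorm : ℂ) := by
  obtain ⟨ξ, hξ, hGξ⟩ := G.exists_norm_eq_supNorm
  obtain ⟨θ, hθ⟩ := Complex.exists_circle_mul_eq_norm (G ξ)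
  have hbound : ∀ t, ‖(θ : ℂ) * g t ξ‖ ≤ (g t).supNorm := fun t => by
    rw [norm_mul, Circle.norm_coe, one_mul]
    exact (g t).norm_le_supNorm' hξ.le
  have hint : Integrable fun t => (θ : ℂ) * g t ξ := (integrable_symbol hp' hW hI hξ.le).const_mul _
  have hre : ∫ t, ((θ : ℂ) * g t ξ).re = ‖G ξ‖ := by
    have h1 : ∫ t, ((θ : ℂ) * g t ξ).re = (∫ t, (θ : ℂ) * g t ξ).re := integral_re hint
    rw [h1, integral_const_mul, ← hG, hθ, Complex.ofReal_re]
  have hint' : Integrable fun t => ((θ : ℂ) * g t ξ).re := hint.re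
  have hnn : ∀ t, 0 ≤ (g t).supNorm - ((θ : ℂ) * g t ξ).re := fun t =>
    sub_nonneg.2 ((Complex.re_le_norm _).trans (hbound t))
  have hsupi := integrable_supNorm hp' hW hI
  have hzero : ∫ t, ((g t).supNorm - ((θ : ℂ) * g t ξ).re) = 0 := by
    refine le_antisymm ?_ (integral_nonneg hnn)
    rw [integral_sub hsupi hint', hre, hGξ]
    linarith
  have hae := (integral_eq_zero_iff_of_nonneg hnn (hsupi.sub hint')).1 hzero
  refine ⟨⟨ξ, mem_sphere_zero_iff_norm.2 hξ⟩, θ, ?_⟩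
  filter_upwards [hae] with t ht
  exact Complex.eq_ofReal_of_norm_le_of_le_re (hbound t) (sub_eq_zero.1 ht).le

theorem integral_supNorm_le_of_ae_eq
    {G : DiscAlgebra} (hG : ∀ z, G z = ∫ t, g t z) {ξ θ : Circle}
    (h : ∀ᵐ t, (θ : ℂ) * g t (ξ : ℂ) = ((g t).supNorm : ℂ)) :
    ∫ t, (g t).supNorm ≤ G.supNorm := by
  have h1 : ((∫ t, (g t).supNorm : ℝ) : ℂ) = θ * G ξ := by
    rw [hG, ← integral_const_mul, ← integral_complex_ofReal]
    exact integral_congr_ae (h.mono fun t ht => ht.symm)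
  refine (le_abs_self _).trans ?_
  rw [← Real.norm_eq_abs, ← Complex.norm_real, h1, norm_mul, Circle.norm_coe, one_mul]
  exact G.norm_le_supNorm' (Circle.norm_coe ξ).le

end DiscSpace

/-! ### The equivalence -/

theorem mainTheorem4 (k : DiscSpaceKind) (p : ℝ≥0∞) [Fact (1 ≤ p)] (hp : 1 < p) (hp' : p ≠ ∞)
    (g : Ioo (0 : ℝ) 1 → DiscAlgebra) (hW : SatisfiesW (fun t => mulOp k p (g t))) :
    ∃ T : DiscSpace k p →L[ℂ] DiscSpace k p,
      IsStrongIntegral (fun t => mulOp k p (g t)) T ∧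
      List.TFAE [
        ∃ ξ θ : Circle, ∀ᵐ t, (θ : ℂ) * g t (ξ : ℂ) = ((g t).supNorm : ℂ),
        ∃ a ∈ ({weakNullMax T, essNorm T, ‖T‖ₑ} : Set ℝ≥0∞),
          ∃ b ∈ ({∫⁻ t, weakNullMax (mulOp k p (g t)), ∫⁻ t, essNorm (mulOp k p (g t)),
            ∫⁻ t, ‖mulOp k p (g t)‖ₑ} : Set ℝ≥0∞), a = b,
        ∀ a ∈ ({weakNullMax T, essNorm T, ‖T‖ₑ, ∫⁻ t, weakNullMax (mulOp k p (g t)),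
            ∫⁻ t, essNorm (mulOp k p (g t)), ∫⁻ t, ‖mulOp k p (g t)‖ₑ} : Set ℝ≥0∞),
          ∀ b ∈ ({weakNullMax T, essNorm T, ‖T‖ₑ, ∫⁻ t, weakNullMax (mulOp k p (g t)),
            ∫⁻ t, essNorm (mulOp k p (g t)), ∫⁻ t, ‖mulOp k p (g t)‖ₑ} : Set ℝ≥0∞), a = b] := by

  obtain ⟨T, hT⟩ := hW.exists_isStrongIntegral
  refine ⟨T, hT, ?_⟩
  have hn := fun t => DiscSpace.norms_mulOp (k := k) hp hp' (g t)
  -- All three integrals on the right of (b) become the same `I`.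
  simp only [(hn _).1, (hn _).2.1, (hn _).2.2]
  set I := ∫⁻ t, ENNReal.ofReal (g t).supNorm with hIdef
  tfae_have 1 → 3 := by
    rintro ⟨ξ, θ, h⟩
    have hI : I ≠ ∞ := by
      refine DiscSpace.lintegral_supNorm_ne_top hp' hW (Circle.norm_coe ξ) ?_
      filter_upwards [h] with t ht
      have h1 := congrArg norm ht
      rwa [norm_mul, Circle.norm_coe, one_mul, Complex.norm_real,
        Real.norm_of_nonneg (g t).supNorm_nonneg] at h1
    obtain ⟨G, rfl, hG⟩ := DiscSpace.exists_strongIntegral_eq_mulOp hp' hW hI hT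
    have hGI : ENNReal.ofReal G.supNorm = I := by
      rw [hIdef, ← DiscSpace.ofReal_integral_supNorm hp' hW hI]
      exact congrArg _ (le_antisymm (DiscSpace.supNorm_le_integral_supNorm hp' hW hI hG)
        (DiscSpace.integral_supNorm_le_of_ae_eq hG h))
    obtain ⟨h1, h2, h3⟩ := DiscSpace.norms_mulOp (k := k) hp hp' G
    rw [h1, h2, h3, hGI]
    simp
  tfae_have 3 → 2 := fun h =>
    ⟨weakNullMax T, by simp, I, by simp, h _ (by simp) _ (by simp)⟩
  tfae_have 2 → 1 := by
    rintro ⟨a, ha, b, hb, hab⟩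
    have hbI : b = I := by simpa using hb
    have haT : a ≤ ‖T‖ₑ := by
      rcases ha with rfl | rfl | rfl
      · exact (weakNullMax_le_essNorm T).trans (essNorm_le_enorm T)
      · exact essNorm_le_enorm T
      · exact le_rfl
    rw [hab, hbI] at haT
    -- Any equality in (b) gives `I` ≤ ‖T‖, and `T` is bounded.
    have hI : I ≠ ∞ := (haT.trans_lt enorm_lt_top).ne
    obtain ⟨G, rfl, hG⟩ := DiscSpace.exists_strongIntegral_eq_mulOp hp' hW hI hT
    refine DiscSpace.exists_ae_eq_supNorm hp' hW hI hG ?_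
    rw [(DiscSpace.norms_mulOp hp hp' G).2.2, hIdef,
      ← DiscSpace.ofReal_integral_supNorm hp' hW hI,
      ENNReal.ofReal_le_ofReal_iff G.supNorm_nonneg] at haT
    exact haT
  tfae_finish
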